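/- Let $\mathbb{K}$ be a field of characteristic $0$ and let $H_{CK}=\mathbb{K}[\mathcal{T}]$ be the Connes–Kreimer Hopf algebra, where $\mathcal{T}$ is the set of non-empty finite rooted trees (without plane structure); forests are monomials, and $\Delta(t)=t\otimes 1+1\otimes t+\sum_c P^c(t)\otimes R^c(t)$ for a tree $t$, the sum being over its non-empty admissible cuts $c$ (non-empty sets of edges, no two on a common path from the root to a leaf), with $R^c(t)$ the component containing the root after removal of $c$ and $P^c(t)$ the forest of the other components. It is graded by the number of vertices. Let $B_+$ be the linear operator sending a forest $t_1\cdots t_k$ to the tree with a new root whose children are the roots of $t_1,\dots,t_k$; it extends to the graded completion of $H_{CK}$. Let $\mathcal{S}eq$ be the set of sequences $(t_k)_{k\ge 1}$ in $H_{CK}$ such that each $t_k$ is a nonzero linear combination of trees with $k$ vertices, $t_1$ is the one-vertex tree, and the subalgebra generated by the $t_k$ is a Hopf subalgebra of $H_{CK}$. For $(t_k)_{k\geq 1}\in\mathcal{S}eq$ let $\lambda_{i,j}$ ($i,j\ge 1$) be the coefficient of $t_j\otimes t_i$ in $\Delta(t_{i+j})$, written in terms of tensor products of monomials in the (algebraically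 independent) $t_k$. Let $\ell_0=1$ and $\ell_{k}=B_+(\ell_{k-1})$ for $k\geq 1$ be the ladders, and for $k\ge 1$ put $$p_k=\sum_{m=1}^k\ \sum_{\substack{j_1+\cdots+j_m=k\\ j_1,\dots,j_m\ge 1}}\frac{(-1)^{m+1}}{m}\,\ell_{j_1}\cdots\ell_{j_m}.$$ **Proposition.** Let $n\ge 1$ and let $b\in\mathbb{K}$ be nonzero. In the graded completion of $H_{CK}$ let $$Z_n(b)=B_+\bigl(\exp(p_1+\cdots+p_{n-1}+b\,p_n)\bigr)=\sum_{k\ge 1}z_k,$$ with $z_k$ homogeneous of degree $k$. Then $(z_k)_{k\ge 1}\in\mathcal{S}eq$, and the corresponding array is, for all $i,j\ge 1$, $$\lambda_{i,j}=\begin{cases}1&\text{if } j<n,\\ b&\text{if } j=n,\\ 0&\text{otherwise.}\end{cases}$$ -/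

import Mathlib

open scoped TensorProduct

noncomputable section

namespace CK

/-! Rooted trees -/

/-- Finite nonempty plane rooted trees: a root with an ordered list of `k` children subtrees. -/
inductive PTree : Type
  | node (k : ℕ) (child : Fin k → PTree) : PTree

namespace PTree

/-- Isomorphism of rooted trees, forgetting the plane structure. -/
def Iso : PTree → PTree → Prop
  | node k c, node l d => ∃ σ : Fin k ≃ Fin l, ∀ i, Iso (c i) (d (σ i))

theorem Iso.refl : ∀ t : PTree, Iso t t
  | node _ c => ⟨Equiv.refl _, fun i => Iso.refl (c i)⟩

theorem Iso.symm : ∀ {t u : PTree}, Iso t u → Iso u t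
  | node _ c, node _ d, ⟨σ, h⟩ => ⟨σ.symm, fun j => by
      have := Iso.symm (h (σ.symm j))
      rwa [Equiv.apply_symm_apply] at this⟩

theorem Iso.trans : ∀ {t u v : PTree}, Iso t u → Iso u v → Iso t v
  | node _ _, node _ _, node _ _, ⟨σ, h⟩, ⟨τ, h'⟩ =>
      ⟨σ.trans τ, fun i => Iso.trans (h i) (h' (σ i))⟩

instance setoid : Setoid PTree := ⟨Iso, Iso.refl, Iso.symm, Iso.trans⟩

/-- Number of vertices. -/
def size : PTree → ℕ
  | node _ c => 1 + ∑ i, size (c i)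

theorem size_eq_of_iso : ∀ {t u : PTree}, Iso t u → size t = size u
  | node k c, node l d, ⟨σ, h⟩ => by
      simp only [size]
      rw [← Equiv.sum_comp σ (fun j => size (d j))]
      exact congrArg _ (Finset.sum_congr rfl fun i _ => size_eq_of_iso (h i))

/-- The edges of a tree. An edge is named by its lower endpoint, and a vertex by the sequence of
child indices on the path from the root to it; so the edges are the addresses of the vertices
other than the root. -/
def edges : PTree → Finset (List ℕ)
  | node _ c => Finset.univ.biUnion fun i =>
      insert [i.val] ((edges (c i)).image (List.cons i.val))

/-- The subtree consisting of the vertex with the given address and all its descendants (the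
value at a list which is not an address is irrelevant). -/
def subtree : PTree → List ℕ → PTree
  | t, [] => t
  | node k c, i :: a => if h : i < k then subtree (c ⟨i, h⟩) a else node k c

theorem size_subtree_lt : ∀ (t : PTree) (e : List ℕ), e ∈ t.edges → (t.subtree e).size < t.size
  | node k c, e, he => by
      simp only [edges, Finset.mem_biUnion, Finset.mem_univ, true_and, Finset.mem_insert,
        Finset.mem_image] at he
      obtain ⟨i, hi⟩ := he
      have hle : (c i).size ≤ ∑ j, (c j).size :=
        Finset.single_le_sum (f := fun j => (c j).size) (fun _ _ => Nat.zero_le _)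
          (Finset.mem_univ i)
      rcases hi with rfl | ⟨a, ha, rfl⟩
      · simp only [subtree, i.isLt, dif_pos, size, Fin.eta]
        omega
      · have := size_subtree_lt (c i) a ha
        simp only [subtree, i.isLt, dif_pos, size, Fin.eta]
        omega

/-- The non-empty admissible cuts: non-empty sets of edges no two of which lie on a common path
from the root to a leaf. Two edges lie on such a path exactly if the address of one is a prefix
of the address of the other. -/
def cuts (t : PTree) : Finset (Finset (List ℕ)) :=
  t.edges.powerset.filter fun c => c.Nonempty ∧ ∀ e ∈ c, ∀ f ∈ c, e <+: f → e = f

theorem mem_edges_of_mem_cuts {t : PTree} {c : Finset (List ℕ)} (hc : c ∈ t.cuts)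
    {e : List ℕ} (he : e ∈ c) : e ∈ t.edges :=
  Finset.mem_powerset.1 (Finset.mem_filter.1 hc).1 he

end PTree

/-- Rooted trees without plane structure, up to isomorphism. -/
abbrev RTree : Type := Quotient PTree.setoid

namespace RTree

/-- Number of vertices. -/
def size : RTree → ℕ := Quotient.lift PTree.size fun _ _ h => PTree.size_eq_of_iso h

/-- The tree whose root has the given trees as its children subtrees. -/
def graft (s : Multiset RTree) : RTree :=
  ⟦PTree.node s.toList.length fun i => (s.toList.get i).out⟧

/-- The one-vertex tree. -/
def bullet : RTree := ⟦PTree.node 0 Fin.elim0⟧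

end RTree

/-- The component containing the root after removal of the edges of the cut `c`. -/
def PTree.trunk : PTree → Finset (List ℕ) → RTree
  | .node _ d, c => RTree.graft <|
      (Finset.univ.filter fun i => [i.val] ∉ c).val.map fun i =>
        PTree.trunk (d i) (c.preimage (List.cons i.val) (List.cons_injective.injOn))

/-! The Connes-Kreimer Hopf algebra -/

/-- The algebra `𝕂[𝒯]`; a forest is a monomial. -/
abbrev HCK (K : Type*) [Field K] : Type _ := MvPolynomial RTree K

section

variable (K : Type*) [Field K]

/-- A tree as an element of the algebra. -/
def tree (t : PTree) : HCK K := MvPolynomial.X (⟦t⟧ : RTree)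

/-- The forest of the trees cut off by the cut `c`. -/
def cutForest (t : PTree) (c : Finset (List ℕ)) : HCK K := ∏ e ∈ c, tree K (t.subtree e)

/-- The coproduct of a tree `t`: the sum of `t ⊗ 1`, `1 ⊗ t` and of `P^c(t) ⊗ R^c(t)` over the
non-empty admissible cuts `c`. -/
def comulTree (t : PTree) : HCK K ⊗[K] HCK K :=
  tree K t ⊗ₜ[K] 1 + 1 ⊗ₜ[K] tree K t +
    ∑ c ∈ t.cuts, cutForest K t c ⊗ₜ[K] (MvPolynomial.X (t.trunk c) : HCK K)

/-- The coproduct, multiplicative. Any plane representative of a tree gives the same value. -/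
def comul : HCK K →ₐ[K] HCK K ⊗[K] HCK K :=
  MvPolynomial.aeval fun t : RTree => comulTree K t.out

/-- The antipode on trees, `S(t) = -t - ∑_c S(P^c(t)) R^c(t)`. -/
def antipodeTree (t : PTree) : HCK K :=
  -tree K t - ∑ c ∈ t.cuts.attach,
    (∏ e ∈ c.1.attach, antipodeTree (t.subtree e.1)) * MvPolynomial.X (t.trunk c.1)
termination_by t.size
decreasing_by exact PTree.size_subtree_lt t e.1 (PTree.mem_edges_of_mem_cuts c.2 e.2)

/-- The antipode, multiplicative. Any plane representative of a tree gives the same value. -/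
def antipode : HCK K →ₐ[K] HCK K :=
  MvPolynomial.aeval fun t : RTree => antipodeTree K t.out

variable {K}

/-- Hopf subalgebras: subalgebras `A` with `Δ(A) ⊆ A ⊗ A` and `S(A) ⊆ A`. -/
def IsHopfSubalgebra (A : Subalgebra K (HCK K)) : Prop :=
  (∀ x ∈ A, comul K x ∈ (Algebra.TensorProduct.map A.val A.val).range) ∧
    ∀ x ∈ A, antipode K x ∈ A

/-- The sequences `(t_n)_{n ≥ 1}` in `𝒮eq`. -/
structure IsSeq (t : ℕ+ → HCK K) : Prop where
  ne_zero : ∀ n, t n ≠ 0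
  mem_span : ∀ n : ℕ+, t n ∈ Submodule.span K
    {x : HCK K | ∃ τ : RTree, τ.size = n ∧ x = MvPolynomial.X τ}
  one : t 1 = MvPolynomial.X RTree.bullet
  hopf : IsHopfSubalgebra (Algebra.adjoin K (Set.range t))

/-- The coefficient of `X_j ⊗ X_i` in an element of `𝕂[X_1, X_2, …] ⊗ 𝕂[X_1, X_2, …]`. -/
def linCoeff (j i : ℕ+) : MvPolynomial ℕ+ K ⊗[K] MvPolynomial ℕ+ K →ₗ[K] K :=
  (TensorProduct.lid K K).toLinearMap ∘ₗ
    TensorProduct.map (MvPolynomial.lcoeff K (Finsupp.single j 1))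
      (MvPolynomial.lcoeff K (Finsupp.single i 1))

/-- `(λ_{i,j})` is the array of `(t_n)`: for all `i, j`, the coproduct of `t_{i+j}` can be
written through tensor products of monomials in the `t_n`, and in every such expression
`λ_{i,j}` is the coefficient of `t_j ⊗ t_i`. -/
def IsArrayOf (lam : ℕ+ → ℕ+ → K) (t : ℕ+ → HCK K) : Prop :=
  ∀ i j : ℕ+,
    (∃ P : MvPolynomial ℕ+ K ⊗[K] MvPolynomial ℕ+ K,
      Algebra.TensorProduct.map (MvPolynomial.aeval t) (MvPolynomial.aeval t) P
        = comul K (t (i + j))) ∧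
    ∀ P : MvPolynomial ℕ+ K ⊗[K] MvPolynomial ℕ+ K,
      Algebra.TensorProduct.map (MvPolynomial.aeval t) (MvPolynomial.aeval t) P
        = comul K (t (i + j)) → linCoeff j i P = lam i j

variable (K) in
/-- The add-a-root operator. -/
def Bplus : HCK K →ₗ[K] HCK K :=
  (MvPolynomial.basisMonomials RTree K).constr K fun m =>
    (MvPolynomial.X (RTree.graft (Finsupp.toMultiset m)) : HCK K)

/-! The graded completion -/

/-- Number of vertices of a forest. -/
def forestSize (m : RTree →₀ ℕ) : ℕ := m.sum fun t a => a * t.size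

theorem PTree.finite_size_le : ∀ n : ℕ, {t : PTree | t.size ≤ n}.Finite
  | 0 => by
      refine Set.Finite.subset Set.finite_empty ?_
      rintro ⟨k, c⟩ h
      simp only [Set.mem_ofPred_eq, PTree.size] at h
      omega
  | n + 1 => by
      refine Set.Finite.subset (s := ⋃ k ∈ Set.Iic n, PTree.node k ''
        Set.pi Set.univ fun _ => {t : PTree | t.size ≤ n}) ?_ ?_
      · exact (Set.finite_Iic n).biUnion fun k _ =>
          (Set.Finite.pi fun _ => PTree.finite_size_le n).image _
      · rintro ⟨k, c⟩ h
        simp only [Set.mem_ofPred_eq, PTree.size] at h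
        have hpos : ∀ t : PTree, 1 ≤ t.size := by
          rintro ⟨l, d⟩
          simp only [PTree.size]
          omega
        have hk : k ≤ ∑ i, (c i).size := by
          have := Finset.sum_le_sum fun (i : Fin k) (_ : i ∈ Finset.univ) => hpos (c i)
          simpa using this
        refine Set.mem_biUnion (x := k) (Set.mem_Iic.2 (by omega)) ⟨c, fun i _ => ?_, rfl⟩
        have := Finset.single_le_sum (f := fun j => (c j).size) (fun _ _ => Nat.zero_le _)
          (Finset.mem_univ i)
        simp only [Set.mem_ofPred_eq]
        omega

theorem RTree.finite_size_le (n : ℕ) : {t : RTree | t.size ≤ n}.Finite := by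
  refine ((PTree.finite_size_le n).image (fun t => (⟦t⟧ : RTree))).subset ?_
  intro t
  induction t using Quotient.inductionOn with
  | _ t => exact fun h => ⟨t, h, rfl⟩

theorem RTree.size_pos (t : RTree) : 0 < t.size := by
  induction t using Quotient.inductionOn with
  | _ t =>
    cases t
    change 0 < PTree.size _
    simp only [PTree.size]
    omega

theorem finite_forestSize_eq (n : ℕ) : {m : RTree →₀ ℕ | forestSize m = n}.Finite := by
  classical
  refine ((RTree.finite_size_le n).toFinset.finsupp
    (fun _ => Finset.range (n + 1))).finite_toSet.subset ?_
  intro m hm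
  have key : ∀ t, m t * t.size ≤ n := by
    intro t
    by_cases ht : t ∈ m.support
    · rw [← hm.out]
      exact Finset.single_le_sum (f := fun t => m t * t.size) (fun _ _ => Nat.zero_le _) ht
    · simp [Finsupp.notMem_support_iff.1 ht]
  rw [Finset.mem_coe, Finset.mem_finsupp_iff]
  refine ⟨fun t ht => ?_, fun t _ => ?_⟩
  · have h1 : 1 ≤ m t := Nat.one_le_iff_ne_zero.2 (Finsupp.mem_support_iff.1 ht)
    simpa using (Nat.le_mul_of_pos_left t.size h1).trans (key t)
  · have := (Nat.le_mul_of_pos_right (m t) t.size_pos).trans (key t)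
    exact Finset.mem_range.2 (by omega)

/-- The graded completion `∏_n H_n` of the algebra. There are finitely many forests with `n`
vertices, so its elements are the arbitrary formal combinations of forests. -/
abbrev HCKhat (K : Type*) [Field K] : Type _ := MvPowerSeries RTree K

/-- The homogeneous component of degree `n`. -/
def component (n : ℕ) (f : HCKhat K) : HCK K :=
  ∑ m ∈ (finite_forestSize_eq n).toFinset, MvPolynomial.monomial m (MvPowerSeries.coeff m f)

/-- The extension of the add-a-root operator to the completion,
`B_+(f) = ∑_k B_+(f_k)` for `f = ∑_k f_k` with `f_k` homogeneous of degree `k`. -/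
def BplusHat (f : HCKhat K) : HCKhat K :=
  fun m => ∑ᶠ k : ℕ, MvPolynomial.coeff m (Bplus K (component k f))

/-- The exponential `∑_k f^k / k!` of an element `f` with constant term zero. -/
def expHat [CharZero K] (f : HCKhat K) : HCKhat K := (PowerSeries.exp K).subst f

/-! The elements `Z_n(b)` -/

variable (K) in
/-- The ladder with `n` vertices, `ℓ_0 = 1`. -/
def ladder : ℕ → HCK K
  | 0 => 1
  | n + 1 => Bplus K (ladder n)

variable (K) in
/-- `p_n = ∑_k ∑_{j_1 + ⋯ + j_k = n} (-1)^(k+1) / k · ℓ_{j_1} ⋯ ℓ_{j_k}`. -/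
def p (n : ℕ) : HCK K :=
  ∑ c : Composition n,
    ((-1 : K) ^ (c.length + 1) / (c.length : K)) • (c.blocks.map (ladder K)).prod

/-- `Z_n(b) = B_+(exp(p_1 + ⋯ + p_{n-1} + b p_n))`. -/
def Z [CharZero K] (n : ℕ) (b : K) : HCKhat K :=
  BplusHat (expHat (((∑ k ∈ Finset.Ico 1 n, p K k) + b • p K n : HCK K) : HCKhat K))

end

end CK

end

noncomputable section

namespace CK

/-! The operator `B_+` is a Hochschild cocycle, `Δ(B_+ x) = B_+ x ⊗ 1 + (id ⊗ B_+)(Δ x)`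
(`comul_Bplus`). Hence the ladder series `L = ∑ ℓ_k X^k` is group-like, and the `p_k` are the
coefficients of `log L` (`coeff_logOf`). Multiplying the coefficients of `log L` by scalars and
exponentiating gives another group-like series `E = ∑ e_k X^k`. For the weights `1, …, 1, b, 0, …`
it satisfies `z_{k+1} = B_+(e_k)`, so `Δ z_{k+1} = z_{k+1} ⊗ 1 + ∑_{i+j=k} e_i ⊗ z_{j+1}`
(`comul_component_Z`).

Since `e_k = ℓ_k` for `k < n`, one has `z_k = ℓ_k` for `1 ≤ k ≤ n`. As the weights vanish beyond
`n`, every `e_k` is a polynomial in `ℓ_1, …, ℓ_n`, hence in the `z`'s. The generated subalgebra is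
therefore stable under `Δ`, and under the antipode because `S(B_+ x) = -∑ S(x₁) B_+(x₂)`. The entry
`λ_{i,j}` is the linear coefficient of `z_j` in `e_j`; modulo products, `log` and `exp` only shift
by `1`, so this coefficient is the `j`-th weight.

Primitive elements are never handled directly. The operation `scaledExpLog`, which sends `L` to the
exponential of its rescaled logarithm, is multiplicative and natural in the coefficient ring.
Applied along `Δ`, this makes `E` group-like; applied along a map to dual numbers, it gives the
linear coefficients. -/

/-! ### Grafting and plane representatives -/

theorem exists_equiv_get_of_perm {α : Type*} {l l' : List α} (h : l.Perm l') :
    ∃ σ : Fin l.length ≃ Fin l'.length, ∀ i, l.get i = l'.get (σ i) := by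
  classical
  refine ⟨⟨h.idxBij, h.symm.idxBij, h.idxBij_rightInverse_idxBij_symm,
    h.idxBij_leftInverse_idxBij_symm⟩, fun i => ?_⟩
  simp

/-- `RTree.graft` lists its children in an arbitrary order and picks arbitrary representatives;
neither choice matters up to isomorphism. -/
theorem mk_node_eq_graft (k : ℕ) (c : Fin k → PTree) :
    (⟦PTree.node k c⟧ : RTree)
      = RTree.graft (Finset.univ.val.map fun i => (⟦c i⟧ : RTree)) := by
  set s : Multiset RTree := Finset.univ.val.map fun i => (⟦c i⟧ : RTree) with hs
  have hperm : (List.ofFn fun i => (⟦c i⟧ : RTree)).Perm s.toList := by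
    rw [← Multiset.coe_eq_coe, Multiset.coe_toList, hs, Fin.univ_val_map]
  obtain ⟨σ, hσ⟩ := exists_equiv_get_of_perm hperm
  refine Quotient.sound ⟨(finCongr (List.length_ofFn).symm).trans σ, fun i => ?_⟩
  have h := hσ (finCongr (List.length_ofFn).symm i)
  have h2 : (List.ofFn fun i => (⟦c i⟧ : RTree)).get (finCongr (List.length_ofFn).symm i)
      = ⟦c i⟧ := by simp
  rw [h2] at h
  refine Quotient.exact (h.trans ?_)
  exact (Quotient.out_eq _).symm

theorem RTree.graft_zero : RTree.graft 0 = RTree.bullet := by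
  have := mk_node_eq_graft 0 Fin.elim0
  simpa [RTree.bullet] using this.symm

theorem RTree.size_graft (s : Multiset RTree) : (RTree.graft s).size = 1 + (s.map RTree.size).sum := by
  have h : ∀ t : RTree, t.out.size = t.size := fun t => by
    conv_rhs => rw [← Quotient.out_eq t]
    rfl
  have h2 : (s.map RTree.size).sum = (s.toList.map RTree.size).sum := by
    conv_lhs => rw [← Multiset.coe_toList s]
    rfl
  change PTree.size _ = _
  rw [PTree.size, h2]
  simp only [h, List.get_eq_getElem]
  congr 1
  rw [← Fin.sum_univ_fun_getElem]

theorem RTree.size_bullet : RTree.bullet.size = 1 := by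
  rw [← RTree.graft_zero, RTree.size_graft]; simp

/-! ### Admissible cuts of a tree in terms of its children -/

namespace PTree

theorem cons_mem_edges {k : ℕ} {c : Fin k → PTree} {i : ℕ} {a : List ℕ} :
    i :: a ∈ (node k c).edges ↔ ∃ h : i < k, a ∈ insert [] (c ⟨i, h⟩).edges := by
  simp only [edges, Finset.mem_biUnion, Finset.mem_univ, true_and, Finset.mem_insert,
    Finset.mem_image, List.cons.injEq]
  constructor
  · rintro ⟨j, ⟨rfl, rfl⟩ | ⟨a', h, rfl, rfl⟩⟩
    · exact ⟨j.2, Or.inl rfl⟩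
    · exact ⟨j.2, Or.inr h⟩
  · rintro ⟨h, rfl | h'⟩
    · exact ⟨⟨i, h⟩, Or.inl ⟨rfl, rfl⟩⟩
    · exact ⟨⟨i, h⟩, Or.inr ⟨a, h', rfl, rfl⟩⟩

theorem nil_notMem_edges (t : PTree) : [] ∉ t.edges := by
  cases t
  simp [edges]

/-- Sets of pairwise incomparable addresses. -/
def IsAntichain (a : Finset (List ℕ)) : Prop := ∀ e ∈ a, ∀ f ∈ a, e <+: f → e = f

open Classical in
/-- The admissible cuts, including the empty one. -/
def admissible (t : PTree) : Finset (Finset (List ℕ)) :=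
  t.edges.powerset.filter IsAntichain

open Classical in
/-- The antichains of vertices of a tree. -/
def antichains (t : PTree) : Finset (Finset (List ℕ)) :=
  (insert [] t.edges).powerset.filter IsAntichain

theorem mem_admissible {t : PTree} {a : Finset (List ℕ)} :
    a ∈ t.admissible ↔ a ⊆ t.edges ∧ IsAntichain a := by
  simp [admissible]

theorem mem_antichains {t : PTree} {a : Finset (List ℕ)} :
    a ∈ t.antichains ↔ a ⊆ insert [] t.edges ∧ IsAntichain a := by
  simp [antichains]

theorem mem_cuts {t : PTree} {a : Finset (List ℕ)} :
    a ∈ t.cuts ↔ a ⊆ t.edges ∧ a.Nonempty ∧ IsAntichain a := by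
  simp [cuts, IsAntichain]

theorem IsAntichain.eq_of_nil_mem {a : Finset (List ℕ)} (h : IsAntichain a) (h0 : [] ∈ a) :
    a = {[]} := by
  ext e
  rw [Finset.mem_singleton]
  exact ⟨fun he => (h [] h0 e he List.nil_prefix).symm, fun he => he ▸ h0⟩

theorem admissible_eq (t : PTree) : t.admissible = insert ∅ t.cuts := by
  ext a
  rw [mem_admissible, Finset.mem_insert, mem_cuts]
  rcases a.eq_empty_or_nonempty with rfl | h
  · simp [IsAntichain]
  · simp [h, h.ne_empty]

theorem empty_notMem_cuts (t : PTree) : ∅ ∉ t.cuts := by simp [mem_cuts]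

/-- The root is comparable with every vertex, so it can only occur in an antichain alone. -/
theorem antichains_eq (t : PTree) : t.antichains = insert {[]} t.admissible := by
  ext a
  rw [mem_antichains, Finset.mem_insert, mem_admissible]
  by_cases h0 : [] ∈ a
  · constructor
    · exact fun h => Or.inl (h.2.eq_of_nil_mem h0)
    · rintro (rfl | h)
      · exact ⟨by simp, by simp [IsAntichain]⟩
      · exact absurd (h.1 h0) t.nil_notMem_edges
  · have h1 : a ≠ {[]} := by rintro rfl; simp at h0
    simp [h1, Finset.subset_insert_iff_of_notMem h0]

theorem root_notMem_admissible (t : PTree) : {[]} ∉ t.admissible := fun h =>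
  t.nil_notMem_edges ((mem_admissible.1 h).1 (Finset.mem_singleton_self _))

theorem trunk_empty : ∀ t : PTree, t.trunk ∅ = ⟦t⟧
  | node k d => by
    rw [trunk, mk_node_eq_graft]
    simp only [Finset.notMem_empty, not_false_eq_true, Finset.filter_true, Finset.preimage_empty]
    exact congrArg _ (Multiset.map_congr rfl fun i _ => trunk_empty (d i))

/-- The cut below the `i`-th child. -/
def childCut (i : ℕ) (C : Finset (List ℕ)) : Finset (List ℕ) :=
  C.preimage (List.cons i) (List.cons_injective.injOn)

@[simp]
theorem mem_childCut {i : ℕ} {C : Finset (List ℕ)} {a : List ℕ} :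
    a ∈ childCut i C ↔ i :: a ∈ C := Finset.mem_preimage

/-- The cut assembled from cuts below the children. -/
def joinCuts {k : ℕ} (p : Fin k → Finset (List ℕ)) : Finset (List ℕ) :=
  Finset.univ.biUnion fun i => (p i).image (List.cons i.val)

theorem mem_joinCuts {k : ℕ} {p : Fin k → Finset (List ℕ)} {e : List ℕ} :
    e ∈ joinCuts p ↔ ∃ i : Fin k, ∃ a ∈ p i, i.val :: a = e := by
  simp [joinCuts]

theorem childCut_joinCuts {k : ℕ} (p : Fin k → Finset (List ℕ)) (i : Fin k) :
    childCut i (joinCuts p) = p i := by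
  ext a
  simp only [mem_childCut, mem_joinCuts, List.cons.injEq]
  constructor
  · rintro ⟨j, b, hb, h, rfl⟩
    rwa [← Fin.ext h]
  · exact fun h => ⟨i, a, h, rfl, rfl⟩

theorem joinCuts_childCut {k : ℕ} {d : Fin k → PTree} {C : Finset (List ℕ)}
    (hC : C ⊆ (node k d).edges) : joinCuts (fun i : Fin k => childCut i C) = C := by
  ext e
  simp only [mem_joinCuts, mem_childCut]
  constructor
  · rintro ⟨i, a, h, rfl⟩
    exact h
  · intro he
    cases e with
    | nil => exact absurd (hC he) (nil_notMem_edges _)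
    | cons i a => exact ⟨⟨i, (cons_mem_edges.1 (hC he)).1⟩, a, he, rfl⟩

/-- Prefixing the child index turns the root of a child into the edge above it. This is why vertex
antichains, rather than cuts, are the right data on the children. -/
theorem joinCuts_mem_admissible {k : ℕ} {d : Fin k → PTree} {p : Fin k → Finset (List ℕ)}
    (hp : ∀ i, p i ∈ (d i).antichains) : joinCuts p ∈ (node k d).admissible := by
  rw [mem_admissible]
  constructor
  · intro e he
    obtain ⟨i, a, ha, rfl⟩ := mem_joinCuts.1 he
    exact cons_mem_edges.2 ⟨i.2, (mem_antichains.1 (hp i)).1 ha⟩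
  · intro e he f hf hef
    obtain ⟨i, a, ha, rfl⟩ := mem_joinCuts.1 he
    obtain ⟨j, a', ha', rfl⟩ := mem_joinCuts.1 hf
    rw [List.cons_prefix_cons] at hef
    obtain rfl := Fin.ext hef.1
    rw [(mem_antichains.1 (hp i)).2 a ha a' ha' hef.2]

theorem childCut_mem_antichains {k : ℕ} {d : Fin k → PTree} {C : Finset (List ℕ)}
    (hC : C ∈ (node k d).admissible) (i : Fin k) : childCut i C ∈ (d i).antichains := by
  rw [mem_admissible] at hC
  rw [mem_antichains]
  constructor
  · intro a ha
    exact (cons_mem_edges.1 (hC.1 (mem_childCut.1 ha))).2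
  · intro a ha b hb hab
    have := hC.2 _ (mem_childCut.1 ha) _ (mem_childCut.1 hb)
      (List.cons_prefix_cons.2 ⟨rfl, hab⟩)
    exact (List.cons.inj this).2

end PTree

/-! ### The cocycle property of grafting -/

theorem prod_tmul_prod {K A B ι : Type*} [CommSemiring K] [CommSemiring A] [CommSemiring B]
    [Algebra K A] [Algebra K B] (s : Finset ι) (a : ι → A) (b : ι → B) :
    ∏ i ∈ s, (a i ⊗ₜ[K] b i) = (∏ i ∈ s, a i) ⊗ₜ[K] (∏ i ∈ s, b i) := by
  classical
  induction s using Finset.induction_on with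
  | empty => simp [Algebra.TensorProduct.one_def]
  | insert i s hi ih => simp [Finset.prod_insert hi, ih]

section
variable (K : Type*) [Field K]

theorem Bplus_monomial (m : RTree →₀ ℕ) : Bplus K (MvPolynomial.monomial m 1)
    = MvPolynomial.X (RTree.graft (Finsupp.toMultiset m)) := by
  have h := (MvPolynomial.basisMonomials RTree K).constr_basis K
    (fun m => (MvPolynomial.X (RTree.graft (Finsupp.toMultiset m)) : HCK K)) m
  rwa [MvPolynomial.coe_basisMonomials] at h

theorem Bplus_prod_X (s : Multiset RTree) :
    Bplus K (s.map fun t => (MvPolynomial.X t : HCK K)).prod = MvPolynomial.X (RTree.graft s) := by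
  classical
  have h : (s.map fun t => (MvPolynomial.X t : HCK K)).prod
      = MvPolynomial.monomial (Multiset.toFinsupp s) 1 := by
    induction s using Multiset.induction_on with
    | empty => simp
    | cons t s ih =>
      rw [Multiset.map_cons, Multiset.prod_cons, ih, MvPolynomial.X, MvPolynomial.monomial_mul,
        one_mul, ← Multiset.singleton_add, map_add, Multiset.toFinsupp_singleton]
  rw [h, Bplus_monomial, Multiset.toFinsupp_toMultiset]

/-- The contribution of an antichain of vertices to the coproduct of a tree. -/
def antichainTerm (t : PTree) (a : Finset (List ℕ)) : HCK K ⊗[K] HCK K :=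
  cutForest K t a ⊗ₜ[K] (if [] ∈ a then 1 else MvPolynomial.X (t.trunk a) : HCK K)

theorem cutForest_joinCuts {k : ℕ} (d : Fin k → PTree) (p : Fin k → Finset (List ℕ)) :
    cutForest K (PTree.node k d) (PTree.joinCuts p) = ∏ i, cutForest K (d i) (p i) := by
  rw [cutForest, PTree.joinCuts, Finset.prod_biUnion]
  · refine Finset.prod_congr rfl fun i _ => ?_
    rw [Finset.prod_image (List.cons_injective.injOn)]
    refine Finset.prod_congr rfl fun a _ => ?_
    simp [PTree.subtree]
  · intro i _ j _ hij
    rw [Function.onFun, Finset.disjoint_left]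
    rintro e he he'
    obtain ⟨a, _, rfl⟩ := Finset.mem_image.1 he
    obtain ⟨b, _, hb⟩ := Finset.mem_image.1 he'
    exact hij (Fin.ext (List.cons.inj hb).1.symm)

/-- A child whose antichain contains its root is cut off entirely and leaves the factor `1`; the
other children leave their trunks. -/
theorem trunk_joinCuts {k : ℕ} (d : Fin k → PTree) (p : Fin k → Finset (List ℕ)) :
    (MvPolynomial.X ((PTree.node k d).trunk (PTree.joinCuts p)) : HCK K)
      = Bplus K (∏ i, if [] ∈ p i then 1 else MvPolynomial.X ((d i).trunk (p i))) := by
  rw [PTree.trunk, ← Bplus_prod_X, Multiset.map_map]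
  congr 1
  change ∏ i ∈ Finset.univ.filter fun i : Fin k => [i.val] ∉ PTree.joinCuts p,
    (MvPolynomial.X ((d i).trunk (PTree.childCut i (PTree.joinCuts p))) : HCK K) = _
  rw [Finset.prod_filter]
  refine Finset.prod_congr rfl fun i _ => ?_
  have h : [i.val] ∈ PTree.joinCuts p ↔ [] ∈ p i := by
    rw [← PTree.mem_childCut, PTree.childCut_joinCuts]
  simp only [h, PTree.childCut_joinCuts, ite_not]

/-- The root antichain accounts for `t ⊗ 1` and the empty one for `1 ⊗ t`. -/
theorem sum_antichainTerm (t : PTree) :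
    ∑ a ∈ t.antichains, antichainTerm K t a = comulTree K t := by
  rw [PTree.antichains_eq, Finset.sum_insert t.root_notMem_admissible, PTree.admissible_eq,
    Finset.sum_insert t.empty_notMem_cuts, comulTree, add_assoc]
  congr 1
  · simp [antichainTerm, cutForest, PTree.subtree]
  congr 1
  · simp [antichainTerm, cutForest, PTree.trunk_empty, tree]
  · refine Finset.sum_congr rfl fun c hc => ?_
    rw [antichainTerm, if_neg fun h => t.nil_notMem_edges ((PTree.mem_cuts.1 hc).1 h)]

/-- Cuts of a tree, the empty one included, correspond to independent choices of an antichain in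
each child. Expanding the product of the children's coproducts therefore enumerates them. -/
theorem comulTree_node (k : ℕ) (d : Fin k → PTree) :
    comulTree K (PTree.node k d) = tree K (PTree.node k d) ⊗ₜ[K] 1 +
      (Bplus K).lTensor (HCK K) (∏ i, comulTree K (d i)) := by
  classical
  have h : ∑ C ∈ (PTree.node k d).admissible,
      cutForest K (PTree.node k d) C ⊗ₜ[K] (MvPolynomial.X ((PTree.node k d).trunk C) : HCK K)
      = (Bplus K).lTensor (HCK K) (∏ i, comulTree K (d i)) := by
    simp only [← sum_antichainTerm]
    rw [Finset.prod_univ_sum, map_sum]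
    symm
    refine Finset.sum_bij' (fun p _ => PTree.joinCuts p) (fun C _ i => PTree.childCut i C)
      (fun p hp => ?_) (fun C hC => ?_) (fun p _ => ?_) (fun C hC => ?_) (fun p _ => ?_)
    · exact PTree.joinCuts_mem_admissible (Fintype.mem_piFinset.1 hp)
    · exact Fintype.mem_piFinset.2 (PTree.childCut_mem_antichains hC)
    · exact funext (PTree.childCut_joinCuts p)
    · exact PTree.joinCuts_childCut (PTree.mem_admissible.1 hC).1
    · simp only [antichainTerm]
      rw [prod_tmul_prod, LinearMap.lTensor_tmul, cutForest_joinCuts, trunk_joinCuts]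
  rw [← h, PTree.admissible_eq, Finset.sum_insert (PTree.empty_notMem_cuts _), comulTree,
    add_assoc]
  simp [cutForest, PTree.trunk_empty, tree]

/-- The recursion `comulTree_node` is symmetric in the children. -/
theorem comulTree_congr : ∀ {t u : PTree}, PTree.Iso t u → comulTree K t = comulTree K u
  | .node k c, .node l d, ⟨σ, h⟩ => by
    rw [comulTree_node, comulTree_node]
    have h1 : tree K (.node k c) = tree K (.node l d) :=
      congrArg MvPolynomial.X (Quotient.sound (show PTree.Iso _ _ from ⟨σ, h⟩))
    rw [h1, ← Equiv.prod_comp σ, Finset.prod_congr rfl fun i _ => comulTree_congr (h i)]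

theorem comul_X (t : RTree) : comul K (MvPolynomial.X t) = comulTree K t.out := by
  rw [comul, MvPolynomial.aeval_X]

theorem comul_tree (t : PTree) : comul K (tree K t) = comulTree K t := by
  rw [tree, comul_X]
  exact comulTree_congr K (Quotient.exact (Quotient.out_eq (⟦t⟧ : RTree)))

theorem linearMap_ext_prod_X {M : Type*} [AddCommGroup M] [Module K M] {f g : HCK K →ₗ[K] M}
    (h : ∀ s : Multiset RTree, f (s.map fun t => (MvPolynomial.X t : HCK K)).prod
      = g (s.map fun t => (MvPolynomial.X t : HCK K)).prod) : f = g := by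
  refine (MvPolynomial.basisMonomials RTree K).ext fun m => ?_
  have := h (Finsupp.toMultiset m)
  rw [Finsupp.toMultiset_map, Finsupp.prod_toMultiset,
    Finsupp.prod_mapDomain_index (by simp) (by simp [pow_add])] at this
  simpa [MvPolynomial.monomial_eq] using this

/-- The grafting operator is a Hochschild cocycle. -/
theorem comul_Bplus (x : HCK K) :
    comul K (Bplus K x) = Bplus K x ⊗ₜ[K] 1 + (Bplus K).lTensor (HCK K) (comul K x) := by
  let f : HCK K →ₗ[K] HCK K ⊗[K] HCK K := (comul K).toLinearMap ∘ₗ Bplus K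
  let g : HCK K →ₗ[K] HCK K ⊗[K] HCK K :=
    (TensorProduct.mk K (HCK K) (HCK K)).flip 1 ∘ₗ Bplus K +
      (Bplus K).lTensor (HCK K) ∘ₗ (comul K).toLinearMap
  suffices h : f = g from LinearMap.congr_fun h x
  refine linearMap_ext_prod_X K fun s => ?_
  simp only [f, g, LinearMap.comp_apply, LinearMap.add_apply, LinearMap.flip_apply,
    TensorProduct.mk_apply, AlgHom.toLinearMap_apply]
  rw [Bplus_prod_X]
  change comul K (tree K _) = tree K _ ⊗ₜ[K] 1 + _
  rw [comul_tree, comulTree_node]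
  congr 2
  rw [map_multiset_prod, Multiset.map_map]
  conv_rhs => rw [← Multiset.coe_toList s]
  rw [Multiset.map_coe, Multiset.prod_coe]
  simp only [Function.comp_def, comul_X]
  rw [← Fin.prod_univ_fun_getElem]
  rfl

/-! ### The antipode on grafted elements -/

/-- The convolution `x ↦ ∑ S(x₁) B(x₂)` of the antipode with a linear map `B`. -/
def antipodeConv (B : HCK K →ₗ[K] HCK K) : HCK K ⊗[K] HCK K →ₗ[K] HCK K :=
  LinearMap.mul' K (HCK K) ∘ₗ TensorProduct.map (antipode K).toLinearMap B

@[simp]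
theorem antipodeConv_tmul (B : HCK K →ₗ[K] HCK K) (x y : HCK K) :
    antipodeConv K B (x ⊗ₜ[K] y) = antipode K x * B y := by
  simp [antipodeConv]

theorem antipode_X (t : RTree) : antipode K (MvPolynomial.X t) = antipodeTree K t.out := by
  rw [antipode, MvPolynomial.aeval_X]

/-- The defining recursion as a convolution. The hypothesis concerns only smaller trees, so the
lemma can serve in the induction proving independence of representatives. -/
theorem antipodeTree_eq_of_smaller (t : PTree)
    (h : ∀ u : PTree, u.size < t.size → antipodeTree K u = antipode K (tree K u)) :
    antipodeTree K t = -antipodeConv K LinearMap.id (comulTree K t - tree K t ⊗ₜ[K] 1) := by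
  rw [antipodeTree, comulTree, add_assoc, add_sub_cancel_left, map_add, map_sum, neg_add',
    ← Finset.sum_attach t.cuts]
  congr 1
  · simp
  · refine Finset.sum_congr rfl fun c _ => ?_
    rw [antipodeConv_tmul, cutForest, map_prod, ← Finset.prod_attach c.1]
    refine congrArg (· * _) (Finset.prod_congr rfl fun e _ => ?_)
    exact h _ (PTree.size_subtree_lt t e.1 (PTree.mem_edges_of_mem_cuts c.2 e.2))

/-- By induction on size, both sides are given by the convolution formula, whose right-hand side
depends only on the isomorphism class because `comulTree` does. -/
theorem antipode_tree (t : PTree) : antipode K (tree K t) = antipodeTree K t := by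
  induction hn : t.size using Nat.strong_induction_on generalizing t with
  | _ n ih =>
    have h : ∀ v : PTree, v.size = n →
        antipodeTree K v = -antipodeConv K LinearMap.id (comulTree K v - tree K v ⊗ₜ[K] 1) :=
      fun v hv => antipodeTree_eq_of_smaller K v fun u hu => (ih _ (hv ▸ hu) u rfl).symm
    have hiso : (⟦t⟧ : RTree).out ≈ t := Quotient.exact (Quotient.out_eq _)
    rw [tree, antipode_X, h _ ((PTree.size_eq_of_iso hiso).trans hn), h t hn,
      comulTree_congr K hiso, tree, tree, Quotient.out_eq]

theorem antipode_X_eq (t : RTree) : antipode K (MvPolynomial.X t) =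
    -antipodeConv K LinearMap.id (comul K (MvPolynomial.X t) - MvPolynomial.X t ⊗ₜ[K] 1) := by
  have h := antipodeTree_eq_of_smaller K t.out fun u _ => (antipode_tree K u).symm
  rw [antipode_X, h, comul_X, tree, Quotient.out_eq]

theorem antipode_Bplus (x : HCK K) :
    antipode K (Bplus K x) = -antipodeConv K (Bplus K) (comul K x) := by
  have h1 : ∀ y, antipodeConv K LinearMap.id ((Bplus K).lTensor (HCK K) y)
      = antipodeConv K (Bplus K) y := fun y => by
    induction y with
    | zero => simp
    | add a b ha hb => simp only [map_add, ha, hb]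
    | tmul a b => simp
  let f : HCK K →ₗ[K] HCK K := (antipode K).toLinearMap ∘ₗ Bplus K
  let g : HCK K →ₗ[K] HCK K := -(antipodeConv K (Bplus K) ∘ₗ (comul K).toLinearMap)
  suffices h : f = g from LinearMap.congr_fun h x
  refine linearMap_ext_prod_X K fun s => ?_
  simp only [f, g, LinearMap.comp_apply, LinearMap.neg_apply, AlgHom.toLinearMap_apply]
  rw [← h1, Bplus_prod_X, antipode_X_eq, ← Bplus_prod_X, comul_Bplus, add_sub_cancel_left]

end

/-! ### Logarithm and exponential of power series through differential equations -/

open PowerSeries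

section ExpLog

theorem hasSubst_sub_one {R : Type*} [CommRing R] {L : R⟦X⟧} (hL : constantCoeff L = 1) :
    HasSubst (L - 1) :=
  HasSubst.of_constantCoeff_zero' (by simp [hL])

variable {R : Type*} [CommRing R] [Algebra ℚ R]

/-- Substitute `L - 1` for `X` in `log' · (1 + X) = 1` and use the chain rule. -/
theorem derivative_logOf_mul {L : R⟦X⟧} (hL : constantCoeff L = 1) :
    d⁄dX R (logOf L) * L = d⁄dX R L := by
  have hs := hasSubst_sub_one hL
  have h1 : d⁄dX R (log R) * (1 + X) = 1 := by
    rw [deriv_log]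
    ext k
    cases k with
    | zero => simp
    | succ k =>
      rw [mul_add, mul_one, map_add, coeff_succ_mul_X, coeff_mk, coeff_mk, ← map_add, coeff_one]
      simp [pow_succ]
  have h2 := congrArg (PowerSeries.subst (L - 1)) h1
  have h3 : (1 : R⟦X⟧).subst (L - 1) = (1 : R⟦X⟧) := by
    rw [← coe_substAlgHom hs, map_one]
  rw [subst_mul hs, subst_add hs, subst_X hs, h3, add_sub_cancel] at h2
  rw [logOf_eq, derivative_subst hs, mul_right_comm, h2, one_mul, map_sub, derivative_one, sub_zero]

/-- `L` is invertible, so the equation fixes the derivative of `P`; over a `ℚ`-algebra this and the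
constant term determine `P`. -/
theorem eq_logOf {P L : R⟦X⟧} (hP : constantCoeff P = 0) (hL : constantCoeff L = 1)
    (h : d⁄dX R P * L = d⁄dX R L) : P = logOf L := by
  have : IsAddTorsionFree R := .of_module_rat _
  have hu : IsUnit L := by rw [isUnit_iff_constantCoeff, hL]; exact isUnit_one
  exact derivative.ext (hu.mul_right_cancel (h.trans (derivative_logOf_mul hL).symm))
    (hP.trans (constantCoeff_logOf hL).symm)

theorem logOf_mul {L M : R⟦X⟧} (hL : constantCoeff L = 1) (hM : constantCoeff M = 1) :
    logOf (L * M) = logOf L + logOf M := by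
  symm
  apply eq_logOf
  · rw [map_add, constantCoeff_logOf hL, constantCoeff_logOf hM, add_zero]
  · rw [map_mul, hL, hM, one_mul]
  · rw [map_add, add_mul, ← mul_assoc, derivative_logOf_mul hL, mul_left_comm,
      derivative_logOf_mul hM, Derivation.leibniz, smul_eq_mul, smul_eq_mul]
    ring

theorem map_logOf {S : Type*} [CommRing S] [Algebra ℚ S] (f : R →+* S) {L : R⟦X⟧}
    (hL : constantCoeff L = 1) : PowerSeries.map f (logOf L) = logOf (PowerSeries.map f L) := by
  rw [logOf_eq, logOf_eq]
  have h := PowerSeries.map_subst (hasSubst_sub_one hL) (h := f) (log R)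
  rw [map_log] at h
  refine h.trans (congrArg (fun a => PowerSeries.subst a (log S)) ?_)
  change PowerSeries.map f (L - 1) = _
  rw [map_sub, map_one]

/-- The exponential of a power series without constant term. -/
def expOf (Q : R⟦X⟧) : R⟦X⟧ := (exp R).subst Q

theorem constantCoeff_expOf {Q : R⟦X⟧} (hQ : constantCoeff Q = 0) :
    constantCoeff (expOf Q) = 1 := by
  have h : exp R = 1 + (exp R - 1) := by ring
  have hs : HasSubst Q := HasSubst.of_constantCoeff_zero' hQ
  have h3 : (1 : R⟦X⟧).subst Q = (1 : R⟦X⟧) := by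
    rw [← coe_substAlgHom hs, map_one]
  rw [expOf, h, subst_add hs, h3, map_add, map_one]
  have : constantCoeff ((exp R - 1).subst Q) = 0 :=
    constantCoeff_subst_eq_zero hQ _ (by simp)
  rw [this, add_zero]

theorem derivative_expOf {Q : R⟦X⟧} (hQ : constantCoeff Q = 0) :
    d⁄dX R (expOf Q) = expOf Q * d⁄dX R Q := by
  rw [expOf, derivative_subst (HasSubst.of_constantCoeff_zero' hQ), derivative_exp]

theorem coeff_succ_expOf {Q : R⟦X⟧} (hQ : constantCoeff Q = 0) (k : ℕ) :
    coeff (k + 1) (expOf Q) * (k + 1) = ∑ ij ∈ Finset.HasAntidiagonal.antidiagonal k,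
      coeff ij.1 (expOf Q) * (coeff (ij.2 + 1) Q * (ij.2 + 1)) := by
  rw [← coeff_derivative, derivative_expOf hQ, coeff_mul]
  simp only [coeff_derivative]

theorem cast_succ_mul_right_cancel {x y : R} (k : ℕ) (h : x * (k + 1) = y * (k + 1)) : x = y := by
  have : IsAddTorsionFree R := .of_module_rat _
  refine nsmul_right_injective k.succ_ne_zero ?_
  simpa [nsmul_eq_mul, mul_comm] using h

/-- The equation `E' = E Q'`, with a prime for the derivative, computes the coefficients of `E`
recursively, and those up to degree `N` involve only the coefficients of `Q` up to degree `N`. -/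
theorem coeff_eq_coeff_expOf {E Q Q' : R⟦X⟧} {N : ℕ} (hE : constantCoeff E = 1)
    (h : d⁄dX R E = E * d⁄dX R Q) (hQ' : constantCoeff Q' = 0)
    (hQQ' : ∀ k ≤ N, coeff k Q = coeff k Q') (k : ℕ) (hk : k ≤ N) :
    coeff k E = coeff k (expOf Q') := by
  induction k using Nat.strong_induction_on with
  | _ k ih =>
    cases k with
    | zero => simp [hE, constantCoeff_expOf hQ']
    | succ k =>
      apply cast_succ_mul_right_cancel k
      rw [coeff_succ_expOf hQ', ← coeff_derivative, h, coeff_mul]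
      refine Finset.sum_congr rfl fun ij hij => ?_
      have := Finset.HasAntidiagonal.mem_antidiagonal.1 hij
      rw [coeff_derivative, ih ij.1 (by omega) (by omega), hQQ' _ (by omega)]

theorem eq_expOf {E Q : R⟦X⟧} (hQ : constantCoeff Q = 0) (hE : constantCoeff E = 1)
    (h : d⁄dX R E = E * d⁄dX R Q) : E = expOf Q := by
  ext k
  exact coeff_eq_coeff_expOf hE h hQ (fun _ _ => rfl) k le_rfl

theorem expOf_add {P Q : R⟦X⟧} (hP : constantCoeff P = 0) (hQ : constantCoeff Q = 0) :
    expOf (P + Q) = expOf P * expOf Q := by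
  symm
  apply eq_expOf
  · rw [map_add, hP, hQ, add_zero]
  · rw [map_mul, constantCoeff_expOf hP, constantCoeff_expOf hQ, one_mul]
  · rw [Derivation.leibniz, derivative_expOf hP, derivative_expOf hQ, map_add, smul_eq_mul,
      smul_eq_mul]
    ring

theorem expOf_logOf {L : R⟦X⟧} (hL : constantCoeff L = 1) : expOf (logOf L) = L := by
  symm
  apply eq_expOf (constantCoeff_logOf hL) hL
  rw [mul_comm, derivative_logOf_mul hL]

theorem map_expOf {S : Type*} [CommRing S] [Algebra ℚ S] (f : R →+* S) {Q : R⟦X⟧}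
    (hQ : constantCoeff Q = 0) : PowerSeries.map f (expOf Q) = expOf (PowerSeries.map f Q) := by
  have h := PowerSeries.map_subst (HasSubst.of_constantCoeff_zero' hQ) (h := f) (exp R)
  rwa [map_exp] at h

/-- The same recursion stays inside a subalgebra, since division by `k + 1` is a scalar
multiplication in characteristic zero. -/
theorem coeff_expOf_mem {K : Type*} [Field K] [CharZero K] [Algebra K R] (A : Subalgebra K R)
    {Q : R⟦X⟧} (hQ : constantCoeff Q = 0) (hA : ∀ k, coeff k Q ∈ A) (k : ℕ) :
    coeff k (expOf Q) ∈ A := by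
  induction k using Nat.strong_induction_on with
  | _ k ih =>
    cases k with
    | zero => simp [constantCoeff_expOf hQ]
    | succ k =>
      have h : coeff (k + 1) (expOf Q) * (k + 1) ∈ A := by
        rw [coeff_succ_expOf hQ]
        refine A.sum_mem fun ij hij => ?_
        have := Finset.HasAntidiagonal.mem_antidiagonal.1 hij
        exact A.mul_mem (ih _ (by omega))
          (A.mul_mem (hA _) (A.add_mem (natCast_mem A _) A.one_mem))
      have h2 := A.smul_mem h ((k + 1 : K)⁻¹)
      have h3 : (k + 1 : R) = algebraMap K R (k + 1) := by simp
      rwa [h3, mul_comm, ← Algebra.smul_def, smul_smul,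
        inv_mul_cancel₀ (Nat.cast_add_one_ne_zero k), one_smul] at h2

end ExpLog

/-! ### Coefficients of the logarithm as sums over compositions -/

section Compositions

/-- The lists of blocks of the compositions of `k` with `d` blocks. -/
def compositionLists (k d : ℕ) : Finset (List ℕ) :=
  (Finset.univ.filter fun c : Composition k => c.length = d).image Composition.blocks

theorem mem_compositionLists {k d : ℕ} {l : List ℕ} :
    l ∈ compositionLists k d ↔ l.length = d ∧ (∀ x ∈ l, 0 < x) ∧ l.sum = k := by
  simp only [compositionLists, Finset.mem_image, Finset.mem_filter, Finset.mem_univ, true_and]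
  constructor
  · rintro ⟨c, rfl, rfl⟩
    exact ⟨c.blocks_length, fun x hx => c.blocks_pos hx, c.blocks_sum⟩
  · rintro ⟨h1, h2, h3⟩
    exact ⟨⟨l, fun {i} => h2 i, h3⟩, h1, rfl⟩

theorem coeff_pow_eq_sum_compositionLists {R : Type*} [CommRing R] {u : R⟦X⟧}
    (hu : coeff 0 u = 0) (d k : ℕ) :
    coeff k (u ^ d) = ∑ l ∈ compositionLists k d, (l.map fun i => coeff i u).prod := by
  induction d generalizing k with
  | zero =>
    rw [pow_zero, coeff_one]
    split_ifs with hk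
    · have : compositionLists k 0 = {[]} := by
        ext l
        rw [mem_compositionLists, Finset.mem_singleton, List.length_eq_zero_iff]
        exact ⟨fun h => h.1, by rintro rfl; simp [hk]⟩
      simp [this]
    · have : compositionLists k 0 = ∅ := by
        refine Finset.eq_empty_of_forall_notMem fun l hl => ?_
        rw [mem_compositionLists, List.length_eq_zero_iff] at hl
        obtain ⟨rfl, -, h⟩ := hl
        exact hk h.symm
      simp [this]
  | succ d ih =>
    rw [pow_succ', coeff_mul]
    simp only [ih, Finset.mul_sum]
    -- Blocks must be positive; terms with first index `0` vanish because `u` has no constant term.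
    rw [← Finset.sum_filter_of_ne (p := fun ij : ℕ × ℕ => ij.1 ≠ 0), Finset.sum_sigma']
    · refine Finset.sum_bij' (fun x _ => x.1.1 :: x.2)
        (fun l _ => ⟨(l.headI, l.tail.sum), l.tail⟩) ?_ ?_ ?_ ?_ ?_
      · rintro ⟨⟨i, j⟩, l⟩ h
        simp only [Finset.mem_sigma, Finset.mem_filter, Finset.HasAntidiagonal.mem_antidiagonal,
          mem_compositionLists] at h
        rw [mem_compositionLists]
        obtain ⟨⟨hij, hi⟩, h1, h2, h3⟩ := h
        refine ⟨by simp [h1], ?_, by simp [h3, hij]⟩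
        intro x hx
        rcases List.mem_cons.1 hx with rfl | hx
        · exact Nat.pos_of_ne_zero hi
        · exact h2 x hx
      · intro l h
        obtain ⟨h1, h2, h3⟩ := mem_compositionLists.1 h
        cases l with
        | nil => simp at h1
        | cons i l =>
          simp only [Finset.mem_sigma, Finset.mem_filter, Finset.HasAntidiagonal.mem_antidiagonal,
            mem_compositionLists, List.headI, List.tail]
          exact ⟨⟨by simpa using h3, (h2 i (by simp)).ne'⟩, by simpa using h1,
            fun x hx => h2 x (List.mem_cons_of_mem _ hx), trivial⟩
      · rintro ⟨⟨i, j⟩, l⟩ h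
        simp only [Finset.mem_sigma, mem_compositionLists] at h
        simp [h.2.2.2]
      · intro l h
        obtain ⟨h1, -, -⟩ := mem_compositionLists.1 h
        cases l with
        | nil => simp at h1
        | cons i l => rfl
      · rintro ⟨⟨i, j⟩, l⟩ h
        simp
    · rintro ⟨i, j⟩ _ h rfl
      refine h (Finset.sum_eq_zero fun l _ => ?_)
      simp only [hu, zero_mul]

theorem coeff_pow_eq_sum_composition {R : Type*} [CommRing R] {u : R⟦X⟧}
    (hu : coeff 0 u = 0) (d k : ℕ) :
    coeff k (u ^ d) = ∑ c : Composition k with c.length = d,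
      (c.blocks.map fun i => coeff i u).prod := by
  rw [coeff_pow_eq_sum_compositionLists hu, compositionLists, Finset.sum_image]
  intro c _ c' _ h
  exact Composition.ext h

/-- Expand `log(1 + u) = ∑ (-1)^(d+1)/d · u^d` with `u = L - 1` and group the compositions by
length. For the ladders this is the definition of `p`. -/
theorem coeff_logOf {K R : Type*} [Field K] [CharZero K] [CommRing R] [Algebra K R] [Algebra ℚ R]
    {l : ℕ → R} (hl : l 0 = 1) {k : ℕ} (hk : k ≠ 0) :
    coeff k (logOf (mk l)) = ∑ c : Composition k,
      ((-1 : K) ^ (c.length + 1) / (c.length : K)) • (c.blocks.map l).prod := by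
  have hL : constantCoeff (mk l) = 1 := by simp [← coeff_zero_eq_constantCoeff_apply, hl]
  have hu : coeff 0 (mk l - 1) = 0 := by simp [hL]
  have hcu : ∀ i, 0 < i → coeff i (mk l - 1) = l i := fun i hi => by
    simp [coeff_one, hi.ne']
  have hpow := coeff_pow_eq_sum_composition hu
  have hblocks : ∀ c : Composition k,
      (c.blocks.map fun i => coeff i (mk l - 1)).prod = (c.blocks.map l).prod := fun c =>
    congrArg List.prod (List.map_congr_left fun i hi => hcu i (c.blocks_pos hi))
  rw [logOf_eq, coeff_subst' (hasSubst_sub_one hL),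
    finsum_eq_sum_of_support_subset (s := Finset.range (k + 1))]
  · rw [← Finset.sum_fiberwise_of_maps_to (s := Finset.univ) (t := Finset.range (k + 1))
      (g := Composition.length) fun c _ => Finset.mem_range.2 (Nat.lt_succ_of_le c.length_le)]
    refine Finset.sum_congr rfl fun d _ => ?_
    rw [hpow, Finset.smul_sum]
    refine Finset.sum_congr rfl fun c hc => ?_
    obtain rfl := (Finset.mem_filter.1 hc).2
    have h0 : c.length ≠ 0 := (c.length_pos_iff.2 (Nat.pos_of_ne_zero hk)).ne'
    rw [hblocks, coeff_log, if_neg h0, smul_eq_mul, Algebra.smul_def]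
    congr 1
    rw [← RingHom.map_rat_algebraMap (algebraMap K R)]
    simp
  -- A composition of `k` has at most `k` blocks, so powers beyond `k` contribute nothing.
  · intro d hd
    rw [Finset.coe_range, Set.mem_Iio]
    by_contra hlt
    refine hd ?_
    beta_reduce
    rw [hpow, Finset.sum_eq_zero, smul_zero]
    intro c hc
    have := (Finset.mem_filter.1 hc).2
    have := c.length_le
    omega

end Compositions

/-! ### Homogeneous components and the graded completion -/

section Grading

variable {K : Type*} [Field K]

theorem coeff_component (k : ℕ) (f : HCKhat K) (m : RTree →₀ ℕ) :
    MvPolynomial.coeff m (component k f) = if forestSize m = k then MvPowerSeries.coeff m f else 0 := by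
  classical
  rw [component, MvPolynomial.coeff_sum]
  simp only [MvPolynomial.coeff_monomial]
  rw [Finset.sum_ite_eq']
  simp

theorem forestSize_single (t : RTree) : forestSize (Finsupp.single t 1) = t.size := by
  simp [forestSize]

theorem forestSize_add (m m' : RTree →₀ ℕ) : forestSize (m + m') = forestSize m + forestSize m' :=
  Finsupp.sum_add_index' (by simp) (by simp [add_mul])

theorem size_graft_toMultiset (m : RTree →₀ ℕ) :
    (RTree.graft (Finsupp.toMultiset m)).size = forestSize m + 1 := by
  rw [RTree.size_graft, add_comm]
  congr 1
  induction m using Finsupp.induction_linear with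
  | zero => simp [forestSize]
  | add m m' hm hm' => rw [map_add, Multiset.map_add, Multiset.sum_add, hm, hm', forestSize_add]
  | single t a => simp [forestSize, Multiset.map_nsmul, Multiset.sum_nsmul]

variable (K) in
/-- The homogeneous linear combinations of trees with `k` vertices. -/
def treeSpan (k : ℕ) : Submodule K (HCK K) :=
  Submodule.span K {x : HCK K | ∃ τ : RTree, τ.size = k ∧ x = MvPolynomial.X τ}

theorem exists_tree_of_coeff_ne_zero {k : ℕ} {x : HCK K} (hx : x ∈ treeSpan K k)
    {m : RTree →₀ ℕ} (hm : MvPolynomial.coeff m x ≠ 0) :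
    ∃ τ : RTree, τ.size = k ∧ m = Finsupp.single τ 1 := by
  classical
  by_contra hne
  refine hm ?_
  induction hx using Submodule.span_induction with
  | mem x h =>
    obtain ⟨τ, rfl, rfl⟩ := h
    rw [MvPolynomial.coeff_X, if_neg]
    rintro rfl
    exact hne ⟨τ, rfl, rfl⟩
  | zero => simp
  | add x y _ _ hx hy =>
    rw [MvPolynomial.coeff_add]
    by_cases h : MvPolynomial.coeff m x = 0
    · by_cases h' : MvPolynomial.coeff m y = 0
      · rw [h, h', add_zero]
      · exact absurd (hy h') h'
    · exact absurd (hx h) h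
  | smul a x _ hx =>
    rw [MvPolynomial.coeff_smul]
    by_cases h : MvPolynomial.coeff m x = 0
    · rw [h, smul_zero]
    · exact absurd (hx h) h

theorem coeff_eq_zero_of_mem_treeSpan {k : ℕ} {x : HCK K} (hx : x ∈ treeSpan K k)
    {m : RTree →₀ ℕ} (hm : forestSize m ≠ k) : MvPolynomial.coeff m x = 0 := by
  by_contra h
  obtain ⟨τ, rfl, rfl⟩ := exists_tree_of_coeff_ne_zero hx h
  exact hm (forestSize_single τ)

theorem Bplus_component_mem_treeSpan (k : ℕ) (f : HCKhat K) :
    Bplus K (component k f) ∈ treeSpan K (k + 1) := by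
  rw [component, map_sum]
  refine Submodule.sum_mem _ fun m hm => ?_
  have hm' : forestSize m = k := by simpa using hm
  rw [← mul_one (MvPowerSeries.coeff m f), ← smul_eq_mul, ← MvPolynomial.smul_monomial, map_smul,
    Bplus_monomial]
  exact Submodule.smul_mem _ _ (Submodule.subset_span
    ⟨_, (size_graft_toMultiset m).trans (by rw [hm']), rfl⟩)

/-- Grafting raises the degree by exactly one, so a single term of the defining sum survives in each
degree. -/
theorem component_succ_BplusHat (k : ℕ) (f : HCKhat K) :
    component (k + 1) (BplusHat f) = Bplus K (component k f) := by
  ext m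
  rw [coeff_component]
  split_ifs with h
  · change (∑ᶠ j : ℕ, MvPolynomial.coeff m (Bplus K (component j f))) = _
    refine finsum_eq_single _ k fun j hj => ?_
    exact coeff_eq_zero_of_mem_treeSpan (Bplus_component_mem_treeSpan j f) (by omega)
  · exact (coeff_eq_zero_of_mem_treeSpan (Bplus_component_mem_treeSpan k f) h).symm

theorem component_zero_BplusHat (f : HCKhat K) : component 0 (BplusHat f) = 0 := by
  ext m
  rw [coeff_component, MvPolynomial.coeff_zero]
  split_ifs with h
  · change (∑ᶠ j : ℕ, MvPolynomial.coeff m (Bplus K (component j f))) = _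
    refine finsum_eq_zero_of_forall_eq_zero fun j => ?_
    exact coeff_eq_zero_of_mem_treeSpan (Bplus_component_mem_treeSpan j f) (by omega)
  · rfl

variable (K) in
/-- The morphism `x ↦ ∑ x_k X^k` recording the homogeneous components. -/
def gradeHom : HCK K →ₐ[K] PowerSeries (HCK K) :=
  MvPolynomial.aeval fun τ => PowerSeries.monomial τ.size (MvPolynomial.X τ : HCK K)

theorem gradeHom_monomial (m : RTree →₀ ℕ) (a : K) :
    gradeHom K (MvPolynomial.monomial m a)
      = PowerSeries.monomial (forestSize m) (MvPolynomial.monomial m a) := by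
  induction m using Finsupp.induction_linear generalizing a with
  | zero =>
    have h : forestSize 0 = 0 := by simp [forestSize]
    rw [h, ← MvPolynomial.C_apply, ← MvPolynomial.algebraMap_eq, AlgHom.commutes,
      PowerSeries.monomial_zero_eq_C_apply, PowerSeries.algebraMap_apply]
  | add m m' hm hm' =>
    rw [← mul_one a, ← MvPolynomial.monomial_mul, map_mul, hm, hm', forestSize_add,
      PowerSeries.monomial_mul_monomial]
  | single τ n =>
    have h : ∀ n : ℕ, gradeHom K (MvPolynomial.monomial (Finsupp.single τ n) 1) =
        PowerSeries.monomial (forestSize (Finsupp.single τ n))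
          (MvPolynomial.monomial (Finsupp.single τ n) 1) := fun n => by
      induction n with
      | zero => simp [forestSize]
      | succ n ih =>
        rw [Finsupp.single_add, forestSize_add, ← one_mul (1 : K), ← MvPolynomial.monomial_mul,
          map_mul, ih, ← PowerSeries.monomial_mul_monomial, forestSize_single]
        congr 1
        exact MvPolynomial.aeval_X _ _
    rw [← mul_one a, ← smul_eq_mul, ← MvPolynomial.smul_monomial, map_smul, h,
      LinearMap.map_smul_of_tower]

theorem coeff_gradeHom (k : ℕ) (x : HCK K) :
    PowerSeries.coeff k (gradeHom K x) = component k (x : HCKhat K) := by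
  classical
  ext m
  rw [coeff_component, MvPolynomial.coeff_coe]
  induction x using MvPolynomial.induction_on' with
  | monomial m' a =>
    rw [gradeHom_monomial, PowerSeries.coeff_monomial, MvPolynomial.coeff_monomial]
    by_cases h : m' = m
    · subst h
      by_cases hk : forestSize m' = k
      · simp [hk]
      · simp [hk, Ne.symm hk]
    · split_ifs <;> simp [MvPolynomial.coeff_monomial, h]
  | add x y hx hy =>
    rw [map_add, map_add, MvPolynomial.coeff_add, MvPolynomial.coeff_add, hx, hy]
    split_ifs <;> simp

/-- Transfers the exponential from the completion to one-variable power series over `HCK K`, where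
the variable records the degree. -/
theorem component_expHat [CharZero K] (k : ℕ) {x : HCK K} (h1 : PowerSeries.constantCoeff (gradeHom K x) = 0) :
    component k (expHat (x : HCKhat K)) = PowerSeries.coeff k (expOf (gradeHom K x)) := by
  have h0 : MvPowerSeries.constantCoeff (x : HCKhat K) = 0 := by
    rw [← PowerSeries.coeff_zero_eq_constantCoeff_apply, coeff_gradeHom] at h1
    have h2 := coeff_component 0 (x : HCKhat K) 0
    rwa [h1, if_pos (by simp [forestSize]), MvPolynomial.coeff_zero, eq_comm,
      MvPowerSeries.coeff_zero_eq_constantCoeff_apply] at h2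
  have hs : PowerSeries.HasSubst (x : HCKhat K) := PowerSeries.HasSubst.of_constantCoeff_zero h0
  have hs1 : PowerSeries.HasSubst (gradeHom K x) := PowerSeries.HasSubst.of_constantCoeff_zero' h1
  ext m
  rw [coeff_component, expOf, PowerSeries.coeff_subst' hs1]
  rw [show MvPolynomial.coeff m = ⇑(MvPolynomial.lcoeff K m) from rfl]
  have hfin := PowerSeries.coeff_subst_finite' hs1 (PowerSeries.exp (HCK K)) k
  change _ = (MvPolynomial.lcoeff K m).toAddMonoidHom _
  rw [AddMonoidHom.map_finsum _ hfin]
  have hterm : ∀ d : ℕ, MvPolynomial.coeff m (PowerSeries.coeff k (gradeHom K x ^ d))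
      = if forestSize m = k then MvPowerSeries.coeff m ((x : HCKhat K) ^ d) else 0 := fun d => by
    rw [← map_pow, coeff_gradeHom, coeff_component, MvPolynomial.coe_pow]
  have hexp : ∀ d : ℕ, (MvPolynomial.lcoeff K m).toAddMonoidHom
      (PowerSeries.coeff d (PowerSeries.exp (HCK K)) • PowerSeries.coeff k (gradeHom K x ^ d))
      = PowerSeries.coeff d (PowerSeries.exp K) •
        (if forestSize m = k then MvPowerSeries.coeff m ((x : HCKhat K) ^ d) else 0) := fun d => by
    rw [← hterm, PowerSeries.coeff_exp, PowerSeries.coeff_exp,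
      ← RingHom.map_rat_algebraMap (algebraMap K (HCK K)), smul_eq_mul, ← Algebra.smul_def]
    exact map_smul (MvPolynomial.lcoeff K m) _ _
  rw [finsum_congr hexp]
  split_ifs with h
  · exact PowerSeries.coeff_subst hs _ _
  · simp

variable (K) in
/-- The tree underlying the ladder with `k + 1` vertices. -/
def ladderTree : ℕ → RTree
  | 0 => RTree.bullet
  | k + 1 => RTree.graft {ladderTree k}

theorem ladder_succ (k : ℕ) : ladder K (k + 1) = MvPolynomial.X (ladderTree k) := by
  induction k with
  | zero =>
    have := Bplus_prod_X K 0
    rw [RTree.graft_zero] at this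
    simpa [ladder, ladderTree] using this
  | succ k ih =>
    have := Bplus_prod_X K {ladderTree k}
    rw [ladder, ih]
    simpa [ladderTree] using this

theorem size_ladderTree (k : ℕ) : (ladderTree k).size = k + 1 := by
  induction k with
  | zero => exact RTree.size_bullet
  | succ k ih => rw [ladderTree, RTree.size_graft]; simp [ih, add_comm]

theorem gradeHom_ladder (k : ℕ) :
    gradeHom K (ladder K k) = PowerSeries.monomial k (ladder K k) := by
  cases k with
  | zero => rw [ladder, map_one, PowerSeries.monomial_zero_eq_C_apply, map_one]
  | succ k => rw [ladder_succ, gradeHom, MvPolynomial.aeval_X, size_ladderTree]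

theorem gradeHom_p (k : ℕ) : gradeHom K (p K k) = PowerSeries.monomial k (p K k) := by
  have h : ∀ l : List ℕ, gradeHom K (l.map (ladder K)).prod
      = PowerSeries.monomial l.sum (l.map (ladder K)).prod := fun l => by
    induction l with
    | nil => simp
    | cons i l ih =>
      rw [List.map_cons, List.prod_cons, map_mul, ih, gradeHom_ladder,
        PowerSeries.monomial_mul_monomial, List.sum_cons]
  rw [p, map_sum, map_sum]
  refine Finset.sum_congr rfl fun c _ => ?_
  rw [map_smul, h, c.blocks_sum, LinearMap.map_smul_of_tower]

end Grading

/-! ### The exponential of a rescaled logarithm -/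

section ScaledLog

open PowerSeries

variable {K : Type*} [Field K] {R : Type*} [CommRing R] [Algebra K R]

/-- The power series obtained by multiplying the coefficients by the given scalars. -/
def scaleCoeff (c : ℕ → K) (P : R⟦X⟧) : R⟦X⟧ := mk fun k => c k • coeff k P

@[simp]
theorem coeff_scaleCoeff (c : ℕ → K) (P : R⟦X⟧) (k : ℕ) :
    coeff k (scaleCoeff c P) = c k • coeff k P := coeff_mk _ _

theorem scaleCoeff_add (c : ℕ → K) (P Q : R⟦X⟧) :
    scaleCoeff c (P + Q) = scaleCoeff c P + scaleCoeff c Q := by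
  ext k; simp

theorem map_scaleCoeff {S : Type*} [CommRing S] [Algebra K S] (f : R →ₐ[K] S) (c : ℕ → K)
    (P : R⟦X⟧) : PowerSeries.map (f : R →+* S) (scaleCoeff c P)
      = scaleCoeff c (PowerSeries.map (f : R →+* S) P) := by
  ext k; simp

theorem constantCoeff_mk_of_eq_one {l : ℕ → R} (hl : l 0 = 1) : constantCoeff (mk l) = 1 := by
  rw [← coeff_zero_eq_constantCoeff_apply, coeff_mk, hl]

variable [Algebra ℚ R]

/-- The exponential of the scaled logarithm of a power series. -/
def scaledExpLog (c : ℕ → K) (L : R⟦X⟧) : R⟦X⟧ := expOf (scaleCoeff c (logOf L))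

theorem constantCoeff_scaleCoeff_logOf (c : ℕ → K) {L : R⟦X⟧} (hL : constantCoeff L = 1) :
    constantCoeff (scaleCoeff c (logOf L)) = 0 := by
  rw [← coeff_zero_eq_constantCoeff_apply, coeff_scaleCoeff, coeff_zero_eq_constantCoeff_apply,
    constantCoeff_logOf hL, smul_zero]

theorem coeff_zero_scaledExpLog (c : ℕ → K) {L : R⟦X⟧} (hL : constantCoeff L = 1) :
    coeff 0 (scaledExpLog c L) = 1 := by
  rw [coeff_zero_eq_constantCoeff_apply, scaledExpLog,
    constantCoeff_expOf (constantCoeff_scaleCoeff_logOf c hL)]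

/-- `log` turns products into sums, rescaling is additive, and `exp` turns sums back into products.
This is what preserves group-likeness. -/
theorem scaledExpLog_mul (c : ℕ → K) {L M : R⟦X⟧} (hL : constantCoeff L = 1)
    (hM : constantCoeff M = 1) :
    scaledExpLog c (L * M) = scaledExpLog c L * scaledExpLog c M := by
  rw [scaledExpLog, logOf_mul hL hM, scaleCoeff_add,
    expOf_add (constantCoeff_scaleCoeff_logOf c hL) (constantCoeff_scaleCoeff_logOf c hM)]
  rfl

theorem map_scaledExpLog {S : Type*} [CommRing S] [Algebra K S] [Algebra ℚ S] (f : R →ₐ[K] S)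
    (c : ℕ → K) {L : R⟦X⟧} (hL : constantCoeff L = 1) :
    PowerSeries.map (f : R →+* S) (scaledExpLog c L)
      = scaledExpLog c (PowerSeries.map (f : R →+* S) L) := by
  rw [scaledExpLog, map_expOf _ (constantCoeff_scaleCoeff_logOf c hL), map_scaleCoeff,
    map_logOf _ hL]
  rfl

theorem coeff_scaledExpLog_of_eq_one {c : ℕ → K} {L : R⟦X⟧} (hL : constantCoeff L = 1) {N : ℕ}
    (hc : ∀ k ≤ N, c k = 1) {k : ℕ} (hk : k ≤ N) :
    coeff k (scaledExpLog c L) = coeff k L := by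
  symm
  refine coeff_eq_coeff_expOf hL (Q := logOf L) ?_ (constantCoeff_scaleCoeff_logOf c hL)
    (fun j hj => ?_) k hk
  · rw [mul_comm, derivative_logOf_mul hL]
  · rw [coeff_scaleCoeff, hc j hj, one_smul]

theorem coeff_one_expOf {Q : R⟦X⟧} (hQ : constantCoeff Q = 0) :
    coeff 1 (expOf Q) = coeff 1 Q := by
  have h := coeff_succ_expOf hQ 0
  simpa [constantCoeff_expOf hQ] using h

theorem coeff_one_scaledExpLog (c : ℕ → K) {L : R⟦X⟧} (hL : constantCoeff L = 1) :
    coeff 1 (scaledExpLog c L) = c 1 • coeff 1 L := by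
  rw [scaledExpLog, coeff_one_expOf (constantCoeff_scaleCoeff_logOf c hL), coeff_scaleCoeff,
    ← coeff_one_expOf (constantCoeff_logOf hL), expOf_logOf hL]

/-- Degree `k` of the logarithm involves only coefficients of index at most `k`, and the degrees
beyond `n` are killed by the weights. -/
theorem scaledExpLog_congr [CharZero K] {c : ℕ → K} {n : ℕ} (hc : ∀ k, n < k → c k = 0)
    {l l' : ℕ → R} (hl : l 0 = 1) (h : ∀ k ≤ n, l k = l' k) :
    scaledExpLog c (mk l) = scaledExpLog c (mk l') := by
  have hl' : l' 0 = 1 := by rw [← h 0 (Nat.zero_le _), hl]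
  rw [scaledExpLog, scaledExpLog]
  congr 1
  ext k
  rw [coeff_scaleCoeff, coeff_scaleCoeff]
  rcases lt_or_ge n k with hk | hk
  · rw [hc k hk, zero_smul, zero_smul]
  · rcases eq_or_ne k 0 with rfl | hk0
    · rw [coeff_zero_eq_constantCoeff_apply, coeff_zero_eq_constantCoeff_apply,
        constantCoeff_logOf (constantCoeff_mk_of_eq_one hl),
        constantCoeff_logOf (constantCoeff_mk_of_eq_one hl')]
    · rw [coeff_logOf (K := K) hl hk0, coeff_logOf (K := K) hl' hk0]
      refine congrArg _ (Finset.sum_congr rfl fun d _ => ?_)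
      rw [List.map_congr_left fun i hi => h i ((d.blocks_le hi).trans hk)]

theorem coeff_scaledExpLog_mem [CharZero K] {c : ℕ → K} {n : ℕ} (hc : ∀ k, n < k → c k = 0)
    {l : ℕ → R} (hl : l 0 = 1) (A : Subalgebra K R) (hA : ∀ k ≤ n, l k ∈ A) (k : ℕ) :
    coeff k (scaledExpLog c (mk l)) ∈ A := by
  have hL := constantCoeff_mk_of_eq_one hl
  refine coeff_expOf_mem A (constantCoeff_scaleCoeff_logOf c hL) (fun j => ?_) k
  rw [coeff_scaleCoeff]
  rcases lt_or_ge n j with hj | hj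
  · rw [hc j hj, zero_smul]; exact A.zero_mem
  · rcases eq_or_ne j 0 with rfl | hj0
    · rw [coeff_zero_eq_constantCoeff_apply, constantCoeff_logOf hL, smul_zero]
      exact A.zero_mem
    · rw [coeff_logOf (K := K) hl hj0]
      refine A.smul_mem (A.sum_mem fun d _ => A.smul_mem (A.list_prod_mem fun x hx => ?_) _) _
      obtain ⟨i, hi, rfl⟩ := List.mem_map.1 hx
      exact hA i ((d.blocks_le hi).trans hj)

/-- When products of coefficients vanish, `log(1 + U) = U` and `exp V = 1 + V`; both follow from the
differential equations. -/
theorem scaledExpLog_one_add_of_mul_eq_zero (c : ℕ → K) {U : R⟦X⟧} (hU : constantCoeff U = 0)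
    (h : ∀ i j, coeff i U * coeff j U = 0) : scaledExpLog c (1 + U) = 1 + scaleCoeff c U := by
  have hlog : logOf (1 + U) = U := by
    symm
    refine eq_logOf hU (by rw [map_add, map_one, hU, add_zero]) ?_
    have : d⁄dX R U * U = 0 := by
      ext k
      rw [coeff_mul]
      refine Finset.sum_eq_zero fun ij _ => ?_
      rw [coeff_derivative, mul_right_comm, h, zero_mul]
    rw [mul_add, mul_one, this, add_zero, map_add, derivative_one, zero_add]
  have h0 : constantCoeff (scaleCoeff c U) = 0 := by
    rw [← coeff_zero_eq_constantCoeff_apply, coeff_scaleCoeff, coeff_zero_eq_constantCoeff_apply,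
      hU, smul_zero]
  rw [scaledExpLog, hlog]
  symm
  refine eq_expOf h0 (by rw [map_add, map_one, h0, add_zero]) ?_
  have : scaleCoeff c U * d⁄dX R (scaleCoeff c U) = 0 := by
    ext k
    rw [coeff_mul]
    refine Finset.sum_eq_zero fun ij _ => ?_
    rw [coeff_derivative, coeff_scaleCoeff, coeff_scaleCoeff, ← mul_assoc, smul_mul_smul_comm, h,
      smul_zero, zero_mul]
  rw [add_mul, one_mul, this, add_zero, map_add, derivative_one, zero_add]

end ScaledLog

/-! ### Linear coefficients through dual numbers -/

section LinearCoefficient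

variable {K : Type*} [Field K] {σ : Type*} [DecidableEq σ]

variable (K) in
/-- Reduction modulo the square of the augmentation ideal and all variables but `X s`. -/
def toDual (s : σ) : MvPolynomial σ K →ₐ[K] DualNumber K :=
  MvPolynomial.aeval fun t => if t = s then DualNumber.eps else 0

theorem toDual_apply (s : σ) (x : MvPolynomial σ K) :
    toDual K s x = TrivSqZeroExt.inl (MvPolynomial.coeff 0 x)
      + TrivSqZeroExt.inr (MvPolynomial.coeff (Finsupp.single s 1) x) := by
  induction x using MvPolynomial.induction_on with
  | C a =>
    rw [← MvPolynomial.algebraMap_eq, AlgHom.commutes, MvPolynomial.algebraMap_eq,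
      MvPolynomial.coeff_C, MvPolynomial.coeff_C, if_pos rfl, if_neg (by simp [eq_comm])]
    simp [TrivSqZeroExt.algebraMap_eq_inl]
  | add x y hx hy =>
    rw [map_add, hx, hy, MvPolynomial.coeff_add, MvPolynomial.coeff_add, TrivSqZeroExt.inl_add,
      TrivSqZeroExt.inr_add]
    abel
  | mul_X x t hx =>
    rw [map_mul, hx, toDual, MvPolynomial.aeval_X, MvPolynomial.coeff_mul_X',
      MvPolynomial.coeff_mul_X']
    by_cases h : t = s
    · subst h
      ext <;> simp
    · simp [h]

end LinearCoefficient

open PowerSeries in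
-- By naturality it suffices to work over the dual numbers, where the generic series becomes `1 + ε
-- X^s` and `ε² = 0`.
theorem toDual_scaledExpLog {K : Type*} [Field K] [CharZero K] (c : ℕ → K)
    {l : ℕ → MvPolynomial ℕ+ K} (hl : l 0 = 1) (hX : ∀ k : ℕ+, l k = MvPolynomial.X k) (s : ℕ+)
    {k : ℕ} (hk : k ≠ 0) :
    toDual K s (coeff k (scaledExpLog c (mk l)))
      = TrivSqZeroExt.inr (if k = s then c k else 0) := by
  let _ : Algebra ℚ (DualNumber K) := Algebra.compHom _ (algebraMap ℚ K)
  have hL := constantCoeff_mk_of_eq_one hl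
  set U : (DualNumber K)⟦X⟧ := monomial (s : ℕ) DualNumber.eps with hU
  have hmap : PowerSeries.map (toDual K s : MvPolynomial ℕ+ K →+* DualNumber K) (mk l) = 1 + U := by
    ext1 j
    rw [coeff_map, coeff_mk, map_add, coeff_one, hU, coeff_monomial]
    rcases Nat.eq_zero_or_pos j with rfl | hj
    · simp [hl, s.ne_zero.symm]
    · obtain ⟨t, rfl⟩ : ∃ t : ℕ+, (t : ℕ) = j := ⟨⟨j, hj⟩, rfl⟩
      rw [hX, if_neg hj.ne', zero_add]
      change toDual K s (MvPolynomial.X t) = _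
      rw [toDual, MvPolynomial.aeval_X]
      exact if_congr PNat.coe_inj.symm rfl rfl
  have h := congrArg (coeff k) (map_scaledExpLog (toDual K s) c hL)
  rw [coeff_map] at h
  refine h.trans ?_
  rw [hmap, scaledExpLog_one_add_of_mul_eq_zero c]
  · rw [map_add, coeff_one, if_neg hk, zero_add, coeff_scaleCoeff, hU, coeff_monomial]
    split_ifs
    · rw [DualNumber.eps, ← TrivSqZeroExt.inr_smul, smul_eq_mul, mul_one]
    · simp
  · rw [← coeff_zero_eq_constantCoeff_apply, hU, coeff_monomial, if_neg s.ne_zero.symm]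
  · intro i j
    rw [hU, coeff_monomial, coeff_monomial]
    split_ifs <;> simp

/-! ### Algebraic independence of homogeneous combinations of trees -/

section AlgebraicIndependence

variable {K : Type*} [Field K]

/-- Choose for each `k` a tree occurring in `t k`. The left inverse sends it to a multiple of `X k`,
normalised by its coefficient, and kills all trees not chosen. -/
theorem exists_algHom_leftInverse {t : ℕ+ → HCK K} (h0 : ∀ k, t k ≠ 0)
    (ht : ∀ k : ℕ+, t k ∈ treeSpan K k) :
    ∃ ψ : HCK K →ₐ[K] MvPolynomial ℕ+ K, ∀ k, ψ (t k) = MvPolynomial.X k := by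
  classical
  have hex : ∀ k : ℕ+, ∃ τ : RTree, τ.size = k ∧
      MvPolynomial.coeff (Finsupp.single τ 1) (t k) ≠ 0 := fun k => by
    obtain ⟨m, hm⟩ := MvPolynomial.ne_zero_iff.1 (h0 k)
    obtain ⟨τ, hτ, rfl⟩ := exists_tree_of_coeff_ne_zero (ht k) hm
    exact ⟨τ, hτ, hm⟩
  choose τ hτ hc using hex
  let a : ℕ+ → K := fun k => MvPolynomial.coeff (Finsupp.single (τ k) 1) (t k)
  let ψ : HCK K →ₐ[K] MvPolynomial ℕ+ K := MvPolynomial.aeval fun u =>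
    if u = τ ⟨u.size, u.size_pos⟩ then
      (a ⟨u.size, u.size_pos⟩)⁻¹ • (MvPolynomial.X ⟨u.size, u.size_pos⟩ : MvPolynomial ℕ+ K)
    else 0
  have key : ∀ (k : ℕ+) (x : HCK K), x ∈ treeSpan K k →
      ψ x = (MvPolynomial.coeff (Finsupp.single (τ k) 1) x * (a k)⁻¹) •
        (MvPolynomial.X k : MvPolynomial ℕ+ K) := by
    intro k x hx
    induction hx using Submodule.span_induction with
    | mem x h =>
      obtain ⟨u, hu, rfl⟩ := h
      have hk : (⟨u.size, u.size_pos⟩ : ℕ+) = k := PNat.coe_injective hu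
      rw [MvPolynomial.aeval_X, hk, MvPolynomial.coeff_X]
      by_cases h : u = τ k
      · rw [if_pos h, if_pos (by rw [h]), one_mul]
      · rw [if_neg h, if_neg, zero_mul, zero_smul]
        rw [Finsupp.single_left_inj one_ne_zero]
        exact h
    | zero => simp
    | add x y _ _ hx hy => rw [map_add, hx, hy, MvPolynomial.coeff_add, add_mul, add_smul]
    | smul b x _ hx => rw [map_smul, hx, MvPolynomial.coeff_smul, smul_eq_mul, smul_smul, mul_assoc]
  refine ⟨ψ, fun k => ?_⟩
  rw [key k _ (ht k), mul_inv_cancel₀ (hc k), one_smul]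

theorem map_aeval_injective {t : ℕ+ → HCK K} (h0 : ∀ k, t k ≠ 0)
    (ht : ∀ k : ℕ+, t k ∈ treeSpan K k) :
    Function.Injective (Algebra.TensorProduct.map (MvPolynomial.aeval (R := K) t)
      (MvPolynomial.aeval (R := K) t)) := by
  obtain ⟨ψ, hψ⟩ := exists_algHom_leftInverse h0 ht
  have h : ψ.comp (MvPolynomial.aeval t) = AlgHom.id K _ :=
    MvPolynomial.algHom_ext fun k => by simp [hψ]
  refine Function.LeftInverse.injective (g := Algebra.TensorProduct.map ψ ψ) fun x => ?_
  rw [← AlgHom.comp_apply, ← Algebra.TensorProduct.map_comp, h, Algebra.TensorProduct.map_id]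
  rfl

end AlgebraicIndependence

/-! ### The sequence of components of `Z` and its array -/

section Main

variable {K : Type*} [Field K]

/-- The scalars by which `Z` multiplies the primitive elements `p_k`. -/
def weight (n : ℕ) (b : K) (k : ℕ) : K := if k < n then 1 else if k = n then b else 0

theorem weight_eq_zero (n : ℕ) (b : K) (k : ℕ) (hk : n < k) : weight n b k = 0 := by
  rw [weight, if_neg (by omega), if_neg (by omega)]

theorem constantCoeff_mk_ladder : PowerSeries.constantCoeff (PowerSeries.mk (ladder K)) = 1 :=
  constantCoeff_mk_of_eq_one rfl

theorem comul_ladder (k : ℕ) : comul K (ladder K k)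
    = ∑ ij ∈ Finset.HasAntidiagonal.antidiagonal k, ladder K ij.1 ⊗ₜ[K] ladder K ij.2 := by
  induction k with
  | zero => simp [ladder, Algebra.TensorProduct.one_def]
  | succ k ih =>
    rw [ladder, comul_Bplus, ih, Finset.Nat.sum_antidiagonal_succ', map_sum]
    simp only [LinearMap.lTensor_tmul]
    rw [ladder]
    rfl

variable (K) in
/-- The generic sequence `1, X_1, X_2, …`. -/
def genericSeq : ℕ → MvPolynomial ℕ+ K
  | 0 => 1
  | k + 1 => MvPolynomial.X k.succPNat

theorem genericSeq_coe (k : ℕ+) : genericSeq K k = MvPolynomial.X k := by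
  rw [← PNat.natPred_add_one k, genericSeq, PNat.succPNat_natPred]

theorem antipode_ladder_mem {n : ℕ} (A : Subalgebra K (HCK K)) (hA : ∀ k ≤ n, ladder K k ∈ A)
    (k : ℕ) (hk : k ≤ n) : antipode K (ladder K k) ∈ A := by
  induction k using Nat.strong_induction_on with
  | _ k ih =>
    cases k with
    | zero => rw [ladder, map_one]; exact A.one_mem
    | succ k =>
      rw [ladder, antipode_Bplus, comul_ladder, map_sum]
      refine A.neg_mem (A.sum_mem fun ij hij => ?_)
      have := Finset.HasAntidiagonal.mem_antidiagonal.1 hij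
      rw [antipodeConv_tmul]
      exact A.mul_mem (ih _ (by omega) (by omega)) (hA (ij.2 + 1) (by omega))

variable [CharZero K]

/-- The homogeneous components of the exponential inside `Z`. -/
def expComponent (n : ℕ) (b : K) (k : ℕ) : HCK K :=
  PowerSeries.coeff k (scaledExpLog (weight n b) (PowerSeries.mk (ladder K)))

/-- Identifies the exponent in `Z` with the rescaled logarithm of the ladder series. -/
theorem gradeHom_weighted_sum {n : ℕ} (hn : 1 ≤ n) (b : K) :
    gradeHom K ((∑ k ∈ Finset.Ico 1 n, p K k) + b • p K n)
      = scaleCoeff (weight n b) (PowerSeries.logOf (PowerSeries.mk (ladder K))) := by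
  ext1 k
  rw [map_add, map_sum, map_smul, map_add, map_sum, PowerSeries.coeff_smul, gradeHom_p,
    coeff_scaleCoeff]
  simp only [gradeHom_p, PowerSeries.coeff_monomial]
  rw [Finset.sum_ite_eq]
  rcases eq_or_ne k 0 with rfl | hk
  · rw [PowerSeries.coeff_zero_eq_constantCoeff_apply,
      PowerSeries.constantCoeff_logOf constantCoeff_mk_ladder, if_neg (by simp), if_neg (by omega),
      smul_zero, smul_zero, add_zero]
  · rw [coeff_logOf (K := K) rfl hk]
    change _ = weight n b k • p K k
    rw [weight]
    rcases lt_trichotomy k n with h | rfl | h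
    · rw [if_pos (Finset.mem_Ico.2 ⟨by omega, h⟩), if_neg h.ne, if_pos h, smul_zero, add_zero,
        one_smul]
    · simp
    · rw [if_neg (by simp; omega), if_neg h.ne', if_neg h.not_gt, if_neg h.ne', smul_zero,
        zero_smul, add_zero]

theorem component_zero_Z (n : ℕ) (b : K) : component 0 (Z n b) = 0 :=
  component_zero_BplusHat _

theorem component_succ_Z {n : ℕ} (hn : 1 ≤ n) (b : K) (k : ℕ) :
    component (k + 1) (Z n b) = Bplus K (expComponent n b k) := by
  have h := gradeHom_weighted_sum hn b
  rw [Z, component_succ_BplusHat, component_expHat, h]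
  · rfl
  · rw [h]
    exact constantCoeff_scaleCoeff_logOf _ constantCoeff_mk_ladder

theorem expComponent_homogeneous {n : ℕ} (hn : 1 ≤ n) (b : K) {k : ℕ} {m : RTree →₀ ℕ}
    (hm : forestSize m ≠ k) : MvPolynomial.coeff m (expComponent n b k) = 0 := by
  have h := gradeHom_weighted_sum hn b
  have h2 : expComponent n b k = component k
      (expHat (((∑ k ∈ Finset.Ico 1 n, p K k) + b • p K n : HCK K) : HCKhat K)) := by
    rw [component_expHat, h]
    · rfl
    · rw [h]
      exact constantCoeff_scaleCoeff_logOf _ constantCoeff_mk_ladder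
  rw [h2, coeff_component, if_neg hm]

theorem expComponent_zero (n : ℕ) (b : K) : expComponent n b 0 = 1 :=
  coeff_zero_scaledExpLog _ constantCoeff_mk_ladder

theorem expComponent_one (n : ℕ) (b : K) :
    expComponent n b 1 = weight n b 1 • MvPolynomial.X RTree.bullet := by
  rw [expComponent, coeff_one_scaledExpLog _ constantCoeff_mk_ladder, PowerSeries.coeff_mk]
  exact congrArg _ (ladder_succ 0)

theorem expComponent_of_lt {n : ℕ} (b : K) {k : ℕ} (hk : k < n) :
    expComponent n b k = ladder K k := by
  -- The bound is `n - 1` because the weight at `n` is already `b`.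
  have hw : ∀ j ≤ n - 1, weight n b j = 1 := fun j hj => if_pos (by omega)
  rw [expComponent, coeff_scaledExpLog_of_eq_one constantCoeff_mk_ladder hw (by omega),
    PowerSeries.coeff_mk]

/-- `Δ` maps the ladder series to the product of its images under the two inclusions; naturality and
multiplicativity of `scaledExpLog` carry this over to the rescaled series. -/
theorem comul_expComponent (n : ℕ) (b : K) (k : ℕ) : comul K (expComponent n b k)
    = ∑ ij ∈ Finset.HasAntidiagonal.antidiagonal k,
      expComponent n b ij.1 ⊗ₜ[K] expComponent n b ij.2 := by
  let f₁ : HCK K →ₐ[K] HCK K ⊗[K] HCK K := Algebra.TensorProduct.includeLeft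
  let f₂ : HCK K →ₐ[K] HCK K ⊗[K] HCK K := Algebra.TensorProduct.includeRight
  have hL := constantCoeff_mk_ladder (K := K)
  have hf : ∀ f : HCK K →ₐ[K] HCK K ⊗[K] HCK K, PowerSeries.constantCoeff
      (PowerSeries.map (f : HCK K →+* HCK K ⊗[K] HCK K) (PowerSeries.mk (ladder K))) = 1 :=
    fun f => by
      rw [← PowerSeries.coeff_zero_eq_constantCoeff_apply, PowerSeries.coeff_map,
        PowerSeries.coeff_zero_eq_constantCoeff_apply, hL, map_one]
  have h1 : PowerSeries.map (comul K : HCK K →+* HCK K ⊗[K] HCK K) (PowerSeries.mk (ladder K))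
      = PowerSeries.map (f₁ : HCK K →+* HCK K ⊗[K] HCK K) (PowerSeries.mk (ladder K))
        * PowerSeries.map (f₂ : HCK K →+* HCK K ⊗[K] HCK K) (PowerSeries.mk (ladder K)) := by
    ext1 j
    rw [PowerSeries.coeff_map, PowerSeries.coeff_mk, PowerSeries.coeff_mul]
    refine (comul_ladder j).trans (Finset.sum_congr rfl fun ij _ => ?_)
    rw [PowerSeries.coeff_map, PowerSeries.coeff_map, PowerSeries.coeff_mk, PowerSeries.coeff_mk]
    simp [f₁, f₂]
  have h2 := map_scaledExpLog (comul K) (weight n b) hL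
  rw [h1, scaledExpLog_mul _ (hf f₁) (hf f₂), ← map_scaledExpLog f₁ _ hL,
    ← map_scaledExpLog f₂ _ hL] at h2
  have h3 := congrArg (PowerSeries.coeff k) h2
  rw [PowerSeries.coeff_map, PowerSeries.coeff_mul] at h3
  refine h3.trans (Finset.sum_congr rfl fun ij _ => ?_)
  rw [PowerSeries.coeff_map, PowerSeries.coeff_map]
  simp [f₁, f₂, expComponent]

theorem comul_component_Z {n : ℕ} (hn : 1 ≤ n) (b : K) (k : ℕ) :
    comul K (component (k + 1) (Z n b)) = component (k + 1) (Z n b) ⊗ₜ[K] 1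
      + ∑ ij ∈ Finset.HasAntidiagonal.antidiagonal k,
        expComponent n b ij.1 ⊗ₜ[K] component (ij.2 + 1) (Z n b) := by
  simp only [component_succ_Z hn]
  rw [comul_Bplus, comul_expComponent, map_sum]
  simp only [LinearMap.lTensor_tmul]

theorem component_one_Z {n : ℕ} (hn : 1 ≤ n) (b : K) :
    component 1 (Z n b) = MvPolynomial.X RTree.bullet := by
  have h := component_succ_Z hn b 0
  rw [expComponent_zero] at h
  exact h.trans (ladder_succ 0)

theorem component_Z_eq_ladder {n : ℕ} (hn : 1 ≤ n) (b : K) {k : ℕ} (hk : k < n) :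
    component (k + 1) (Z n b) = ladder K (k + 1) := by
  rw [component_succ_Z hn, expComponent_of_lt b hk, ladder]

theorem component_Z_mem_treeSpan (n : ℕ) (b : K) (k : ℕ) :
    component (k + 1) (Z n b) ∈ treeSpan K (k + 1) := by
  rw [Z, component_succ_BplusHat]
  exact Bplus_component_mem_treeSpan _ _

/-- The part of `Δ z_{k+2}` with the one-vertex tree on the left is `z_{k+1}` times the first
weight. That weight is `1` or `b`, hence nonzero, so nonvanishing propagates by induction. -/
theorem component_Z_ne_zero {n : ℕ} (hn : 1 ≤ n) {b : K} (hb : b ≠ 0) (k : ℕ) :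
    component (k + 1) (Z n b) ≠ 0 := by
  classical
  induction k with
  | zero => rw [component_one_Z hn]; exact MvPolynomial.X_ne_zero _
  | succ k ih =>
    intro h0
    have h := comul_component_Z hn b (k + 1)
    rw [h0, map_zero, TensorProduct.zero_tmul, zero_add] at h
    let e : HCK K ⊗[K] HCK K →ₗ[K] HCK K := (TensorProduct.lid K (HCK K)).toLinearMap ∘ₗ
      (MvPolynomial.lcoeff K (Finsupp.single RTree.bullet 1)).rTensor (HCK K)
    have he : ∀ x y : HCK K, e (x ⊗ₜ[K] y)
        = MvPolynomial.coeff (Finsupp.single RTree.bullet 1) x • y := fun x y => by simp [e]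
    have h1 := congrArg e h
    -- By homogeneity only `e_1` can contain the one-vertex tree as a monomial.
    rw [map_zero, map_sum, Finset.sum_eq_single (1, k)] at h1
    · rw [he, expComponent_one, MvPolynomial.coeff_smul, MvPolynomial.coeff_X, if_pos rfl, smul_eq_mul,
        mul_one, eq_comm, smul_eq_zero] at h1
      refine h1.elim (fun h2 => ?_) ih
      rw [weight] at h2
      split_ifs at h2 with h3 h4
      · exact one_ne_zero h2
      · exact hb h2
      · omega
    · rintro ⟨i, j⟩ hij hne
      rw [Finset.HasAntidiagonal.mem_antidiagonal] at hij
      rw [he, expComponent_homogeneous hn, zero_smul]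
      rw [forestSize_single, RTree.size_bullet]
      rintro rfl
      refine hne (Prod.ext rfl ?_)
      simp only at hij ⊢
      omega
    · intro h2
      refine absurd (Finset.HasAntidiagonal.mem_antidiagonal.2 ?_) h2
      simp only
      omega

/-- The sequence of the homogeneous components of `Z`. -/
def seqZ (n : ℕ) (b : K) (k : ℕ+) : HCK K := component (k : ℕ) (Z n b)

theorem seqZ_succPNat (n : ℕ) (b : K) (k : ℕ) :
    seqZ n b k.succPNat = component (k + 1) (Z n b) := rfl

theorem ladder_mem_adjoin {n : ℕ} (hn : 1 ≤ n) (b : K) (k : ℕ) (hk : k ≤ n) :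
    ladder K k ∈ Algebra.adjoin K (Set.range (seqZ n b)) := by
  cases k with
  | zero => exact Subalgebra.one_mem _
  | succ k =>
    rw [← component_Z_eq_ladder hn b hk, ← seqZ_succPNat]
    exact Algebra.subset_adjoin ⟨_, rfl⟩

theorem expComponent_mem {n : ℕ} (b : K) (A : Subalgebra K (HCK K))
    (hA : ∀ k ≤ n, ladder K k ∈ A) (k : ℕ) : expComponent n b k ∈ A :=
  coeff_scaledExpLog_mem (weight_eq_zero n b) rfl A hA k

theorem isHopfSubalgebra_adjoin_seqZ {n : ℕ} (hn : 1 ≤ n) (b : K) :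
    IsHopfSubalgebra (Algebra.adjoin K (Set.range (seqZ n b))) := by
  set A := Algebra.adjoin K (Set.range (seqZ n b)) with hAdef
  have hA := ladder_mem_adjoin hn b
  have hz : ∀ k, component (k + 1) (Z n b) ∈ A := fun k =>
    Algebra.subset_adjoin ⟨k.succPNat, rfl⟩
  constructor
  · have htmul : ∀ x ∈ A, ∀ y ∈ A,
        x ⊗ₜ[K] y ∈ (Algebra.TensorProduct.map A.val A.val).range := fun x hx y hy =>
      ⟨(⟨x, hx⟩ : A) ⊗ₜ[K] (⟨y, hy⟩ : A), Algebra.TensorProduct.map_tmul _ _ _ _⟩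
    suffices h : A ≤ (Algebra.TensorProduct.map A.val A.val).range.comap (comul K) from
      fun x hx => h hx
    refine Algebra.adjoin_le ?_
    rintro _ ⟨m, rfl⟩
    obtain ⟨k, rfl⟩ : ∃ k : ℕ, m = k.succPNat := ⟨m.natPred, (PNat.succPNat_natPred m).symm⟩
    change comul K (seqZ n b k.succPNat) ∈ (Algebra.TensorProduct.map A.val A.val).range
    rw [seqZ_succPNat, comul_component_Z hn]
    refine Subalgebra.add_mem _ (htmul _ (hz k) _ A.one_mem) (Subalgebra.sum_mem _ fun ij _ => ?_)
    exact htmul _ (expComponent_mem b A hA _) _ (hz _)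
  · suffices h : A ≤ A.comap (antipode K) from fun x hx => h hx
    refine Algebra.adjoin_le ?_
    rintro _ ⟨m, rfl⟩
    obtain ⟨k, rfl⟩ : ∃ k : ℕ, m = k.succPNat := ⟨m.natPred, (PNat.succPNat_natPred m).symm⟩
    change antipode K (seqZ n b k.succPNat) ∈ A
    rw [seqZ_succPNat, component_succ_Z hn, antipode_Bplus, comul_expComponent, map_sum]
    refine A.neg_mem (A.sum_mem fun ij _ => ?_)
    rw [antipodeConv_tmul, ← component_succ_Z hn]
    -- Membership is applied to the preimage of `A` under the antipode, which reduces the claim to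
    -- antipodes of the ladders up to `n`.
    exact A.mul_mem (expComponent_mem b (A.comap (antipode K)) (antipode_ladder_mem A hA) _) (hz _)

theorem isSeq_seqZ {n : ℕ} (hn : 1 ≤ n) {b : K} (hb : b ≠ 0) : IsSeq (seqZ n b) where
  ne_zero m := by
    rw [← PNat.succPNat_natPred m]
    exact component_Z_ne_zero hn hb _
  mem_span m := by
    rw [← PNat.succPNat_natPred m]
    exact component_Z_mem_treeSpan n b _
  one := component_one_Z hn b
  hopf := isHopfSubalgebra_adjoin_seqZ hn b

/-- The polynomials expressing `expComponent` through the components of `Z`. -/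
def genericExpComponent (n : ℕ) (b : K) (k : ℕ) : MvPolynomial ℕ+ K :=
  PowerSeries.coeff k (scaledExpLog (weight n b) (PowerSeries.mk (genericSeq K)))

/-- The `z`'s and the ladders agree only up to index `n`, but the rescaled series depends on no
further terms. -/
theorem aeval_genericExpComponent {n : ℕ} (hn : 1 ≤ n) (b : K) (k : ℕ) :
    MvPolynomial.aeval (seqZ n b) (genericExpComponent n b k) = expComponent n b k := by
  have hL : PowerSeries.constantCoeff (PowerSeries.mk (genericSeq K)) = 1 :=
    constantCoeff_mk_of_eq_one rfl
  have h := congrArg (PowerSeries.coeff k)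
    (map_scaledExpLog (MvPolynomial.aeval (R := K) (seqZ n b)) (weight n b) hL)
  rw [PowerSeries.coeff_map] at h
  refine h.trans ?_
  have hmap : PowerSeries.map (MvPolynomial.aeval (R := K) (seqZ n b) :
      MvPolynomial ℕ+ K →+* HCK K) (PowerSeries.mk (genericSeq K))
      = PowerSeries.mk fun j => MvPolynomial.aeval (seqZ n b) (genericSeq K j) := by
    ext1 j
    rw [PowerSeries.coeff_map, PowerSeries.coeff_mk, PowerSeries.coeff_mk]
    rfl
  have hcongr : scaledExpLog (weight n b) (PowerSeries.mk (ladder K)) =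
      scaledExpLog (weight n b)
        (PowerSeries.mk fun j => MvPolynomial.aeval (seqZ n b) (genericSeq K j)) := by
    refine scaledExpLog_congr (weight_eq_zero n b) rfl fun j hj => ?_
    cases j with
    | zero => rw [genericSeq, map_one, ladder]
    | succ j =>
      rw [genericSeq, MvPolynomial.aeval_X]
      exact (component_Z_eq_ladder hn b hj).symm
  rw [hmap, ← hcongr, expComponent]

theorem coeff_single_genericExpComponent (n : ℕ) (b : K) {k : ℕ} (s : ℕ+) :
    MvPolynomial.coeff (Finsupp.single s 1) (genericExpComponent n b k)
      = if k = s then weight n b k else 0 := by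
  have h0 : genericSeq K 0 = 1 := rfl
  rcases eq_or_ne k 0 with rfl | hk
  · rw [genericExpComponent, coeff_zero_scaledExpLog _ (constantCoeff_mk_of_eq_one h0),
      if_neg s.ne_zero.symm, MvPolynomial.coeff_one, if_neg (by simp [eq_comm])]
  · have h := toDual_scaledExpLog (weight n b) h0 genericSeq_coe s hk
    have h2 := congrArg TrivSqZeroExt.snd ((toDual_apply s _).symm.trans h)
    rw [TrivSqZeroExt.snd_add, TrivSqZeroExt.snd_inl, TrivSqZeroExt.snd_inr, zero_add,
      TrivSqZeroExt.snd_inr] at h2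
    exact h2

theorem isArrayOf_seqZ {n : ℕ} (hn : 1 ≤ n) {b : K} (hb : b ≠ 0) :
    IsArrayOf (fun _ j : ℕ+ => weight n b j) (seqZ n b) := by
  intro i j
  obtain ⟨k, hk⟩ : ∃ k : ℕ, i + j = k.succPNat :=
    ⟨(i + j).natPred, (PNat.succPNat_natPred _).symm⟩
  have hk' : (i : ℕ) + j = k + 1 := by rw [← PNat.add_coe, hk]; rfl
  let P₀ : MvPolynomial ℕ+ K ⊗[K] MvPolynomial ℕ+ K :=
    MvPolynomial.X k.succPNat ⊗ₜ[K] 1 + ∑ rs ∈ Finset.HasAntidiagonal.antidiagonal k,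
      genericExpComponent n b rs.1 ⊗ₜ[K] MvPolynomial.X rs.2.succPNat
  have hP₀ : Algebra.TensorProduct.map (MvPolynomial.aeval (seqZ n b))
      (MvPolynomial.aeval (seqZ n b)) P₀ = comul K (seqZ n b (i + j)) := by
    rw [hk, seqZ_succPNat, comul_component_Z hn, map_add, map_sum]
    simp only [Algebra.TensorProduct.map_tmul, MvPolynomial.aeval_X, map_one,
      aeval_genericExpComponent hn, seqZ_succPNat]
  refine ⟨⟨P₀, hP₀⟩, fun P hP => ?_⟩
  have hseq := isSeq_seqZ hn hb
  obtain rfl : P = P₀ := map_aeval_injective hseq.ne_zero hseq.mem_span (hP.trans hP₀.symm)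
  have hlin : ∀ x y : MvPolynomial ℕ+ K, linCoeff j i (x ⊗ₜ[K] y)
      = MvPolynomial.coeff (Finsupp.single j 1) x * MvPolynomial.coeff (Finsupp.single i 1) y :=
    fun x y => by simp [linCoeff]
  -- The term `X_{k+1} ⊗ 1` has no `X_i` on the right. In the sum, the left factor must have index
  -- `j`; the right factor is then `X_i`, whose index is shifted by one.
  rw [map_add, map_sum, hlin, MvPolynomial.coeff_one, if_neg (by simp [eq_comm]), mul_zero,
    zero_add, Finset.sum_eq_single ((j : ℕ), i.natPred)]
  · rw [hlin, coeff_single_genericExpComponent, if_pos rfl, PNat.succPNat_natPred,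
      MvPolynomial.coeff_X, if_pos rfl, mul_one]
  · rintro ⟨r, s⟩ hrs hne
    rw [hlin, coeff_single_genericExpComponent]
    split_ifs with h
    · refine absurd (Prod.ext h ?_) hne
      rw [Finset.HasAntidiagonal.mem_antidiagonal] at hrs
      have := PNat.natPred_add_one i
      simp only at hrs h ⊢
      omega
    · rw [zero_mul]
  · intro h
    refine absurd (Finset.HasAntidiagonal.mem_antidiagonal.2 ?_) h
    have := PNat.natPred_add_one i
    simp only
    omega

end Main

end CK

end

theorem mainTheorem7 (K : Type*) [Field K] [CharZero K] (n : ℕ) (hn : 1 ≤ n) (b : K)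
    (hb : b ≠ 0) :
    CK.component 0 (CK.Z n b) = 0 ∧
    CK.IsSeq (fun k : ℕ+ => CK.component (k : ℕ) (CK.Z n b)) ∧
    CK.IsArrayOf
      (fun _ j : ℕ+ => if (j : ℕ) < n then 1 else if (j : ℕ) = n then b else 0)
      (fun k : ℕ+ => CK.component (k : ℕ) (CK.Z n b)) :=
  ⟨CK.component_zero_Z n b, CK.isSeq_seqZ hn hb, CK.isArrayOf_seqZ hn hb⟩
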